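/- **Setting.** For $A\in M_4(\mathbb C)$ let $W(A)=\{\langle A\mathbf x,\mathbf x\rangle : \|\mathbf x\|=1\}$ be the numerical range, and let $k(A)$ (the Gau–Wu number) be the maximal size of an orthonormal set $\{\mathbf x_1,\dots,\mathbf x_k\}\subset\mathbb C^4$ with $\langle A\mathbf x_j,\mathbf x_j\rangle\in\partial W(A)$ for all $j$. Put $H_1=(A+A^*)/2$, $H_2=(A-A^*)/(2i)$ and $F(x:y:t)=\det(xH_1+yH_2+tI)$; let $\Gamma_F\subset\mathbb{CP}^2$ be the curve $F=0$ and let $\Gamma_F^\wedge$ be its dual curve (the Zariski closure of the set of tangent lines of $\Gamma_F$ at nonsingular points of its underlying reduced curve, where the line $ax+by+ct=0$ is identified with the point $(a:b:c)$). Identify $X+iY\in\mathbb C$ with $(X:Y:1)$. A real singularity of $\Gamma_F$ is a point of $\mathbb{CP}^2$ with real homogeneous coordinates at which $F$ vanishes to order at least $2$; its order is the order of vanishing of $F$ there. A *support line* of $W(A)$ is a line in $\mathbb C=\mathbb R^2$ that meets $W(A)$ and has $W(A)$ on one side. A *seed* of $A$ is a subset of $\partial W(A)$ that is either (i) the intersection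 of $\partial W(A)$ with a support line of $W(A)$, if this has more than one point, or (ii) a single point of $\partial W(A)\cap\Gamma_F^\wedge$ that is a singular point of (the reduced curve) $\Gamma_F^\wedge$. A real singularity $P=(a:b:c)$ of $\Gamma_F$ *corresponds to a seed* $S$ if its dual line $\{X+iY : aX+bY+c=0\}$ is a support line of $W(A)$ that contains $S$. **Theorem 4.3.** Let $A\in M_4(\mathbb C)$ be unitarily irreducible (not unitarily similar to a direct sum of two smaller matrices). Suppose that $\Gamma_F$ has at least one real singularity corresponding to a seed of $A$, that every real singularity of $\Gamma_F$ corresponding to a seed of $A$ has order $2$, and that no two distinct such singularities are collinear with the origin $(0:0:1)$. Then $k(A)=3$. -/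

import Mathlib

open scoped LinearAlgebra.Projectivization ComplexConjugate

noncomputable section

namespace GauWu

/-! ### Numerical range, Gau–Wu number, unitary irreducibility -/

/-- The numerical range `W(A) = {⟨A x, x⟩ : ‖x‖ = 1}`. The paper's scalar product is linear in its
first argument, Mathlib's `inner` in its second, so `⟨A x, x⟩` is `inner ℂ x (A x)`. -/
def numericalRange {n : ℕ} (A : Matrix (Fin n) (Fin n) ℂ) : Set ℂ :=
  {z | ∃ x : EuclideanSpace ℂ (Fin n), ‖x‖ = 1 ∧ inner ℂ x (Matrix.toEuclideanLin A x) = z}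

/-- The sizes `k` of orthonormal systems `x₁, …, x_k` with all `⟨A x_j, x_j⟩` on `∂W(A)`. -/
def boundarySystemSizes {n : ℕ} (A : Matrix (Fin n) (Fin n) ℂ) : Set ℕ :=
  {k | ∃ x : Fin k → EuclideanSpace ℂ (Fin n), Orthonormal ℂ x ∧
    ∀ j, inner ℂ (x j) (Matrix.toEuclideanLin A (x j)) ∈ frontier (numericalRange A)}

/-- The Gau–Wu number `k(A)`: the maximal size of such a system. -/
def gauWuNumber {n : ℕ} (A : Matrix (Fin n) (Fin n) ℂ) : ℕ :=
  sSup (boundarySystemSizes A)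

/-- The supremum defining `k(A)` is a maximum. -/
theorem gauWuNumber_isGreatest {n : ℕ} (A : Matrix (Fin n) (Fin n) ℂ) :
    IsGreatest (boundarySystemSizes A) (gauWuNumber A) := by
  have hne : (boundarySystemSizes A).Nonempty :=
    ⟨0, fun j => j.elim0, ⟨fun j => j.elim0, fun j => j.elim0⟩, fun j => j.elim0⟩
  have hb : BddAbove (boundarySystemSizes A) := by
    refine ⟨n, ?_⟩
    rintro k ⟨x, hx, -⟩
    simpa using hx.linearIndependent.fintype_card_le_finrank
  exact ⟨Nat.sSup_mem hne hb, fun k hk => le_csSup hb hk⟩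

/-- `A` is unitarily similar to a direct sum `B ⊕ C` of two matrices of positive size. -/
def IsUnitarilyReducible {n : ℕ} (A : Matrix (Fin n) (Fin n) ℂ) : Prop :=
  ∃ (k l : ℕ) (_ : 0 < k) (_ : 0 < l) (e : Fin k ⊕ Fin l ≃ Fin n)
    (B : Matrix (Fin k) (Fin k) ℂ) (C : Matrix (Fin l) (Fin l) ℂ)
    (U : Matrix (Fin n) (Fin n) ℂ),
    U ∈ Matrix.unitaryGroup (Fin n) ℂ ∧
      star U * A * U = Matrix.reindex e e (Matrix.fromBlocks B 0 0 C)

/-- `A` is unitarily irreducible. -/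
def IsUnitarilyIrreducible {n : ℕ} (A : Matrix (Fin n) (Fin n) ℂ) : Prop :=
  ¬ IsUnitarilyReducible A

/-! ### Plane curves in the complex projective plane -/

/-- The complex projective plane with homogeneous coordinates `(x : y : t)`. Lines
`a x + b y + c t = 0` are identified with the points `(a : b : c)` of the same space. -/
abbrev CP2 : Type := ℙ ℂ (Fin 3 → ℂ)

/-- Homogeneous polynomials vanishing on `V`: the homogeneous elements of the ideal of `V`. -/
def vanishing (V : Set CP2) : Set (MvPolynomial (Fin 3) ℂ) :=
  {G | (∃ d : ℕ, G.IsHomogeneous d) ∧ ∀ P ∈ V, MvPolynomial.eval P.rep G = 0}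

/-- The vector of first partial derivatives of `G` at `v`. -/
def grad (G : MvPolynomial (Fin 3) ℂ) (v : Fin 3 → ℂ) : Fin 3 → ℂ :=
  fun i => MvPolynomial.eval v (MvPolynomial.pderiv i G)

/-- The line `L` is the tangent line to the plane curve `V` at one of its nonsingular points:
some homogeneous `G` in the ideal of `V` has a nonzero gradient at a point of `V`, and the
coefficient vector of `L` is that gradient. -/
def IsTangentLine (V : Set CP2) (L : CP2) : Prop :=
  ∃ P ∈ V, ∃ G ∈ vanishing V, ∃ h : grad G P.rep ≠ 0,
    L = Projectivization.mk ℂ (grad G P.rep) h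

/-- The dual curve of `V`: the Zariski closure of the set of tangent lines of `V` at nonsingular
points. (A line contained in `V` as a component contributes one point.) -/
def dualCurve (V : Set CP2) : Set CP2 :=
  {Q | ∀ G ∈ vanishing {L | IsTangentLine V L}, MvPolynomial.eval Q.rep G = 0}

/-- `P` is a singular point of the (reduced) plane curve `V`: all homogeneous polynomials in the
ideal of `V` have zero gradient at `P`. -/
def IsSingularPoint (V : Set CP2) (P : CP2) : Prop :=
  P ∈ V ∧ ∀ G ∈ vanishing V, grad G P.rep = 0

/-- The order (multiplicity) at `P` of the curve `F = 0`, `F` homogeneous: the lowest total degree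
of a monomial occurring in the Taylor expansion of `F` about a representative of `P`. -/
def curveOrder (F : MvPolynomial (Fin 3) ℂ) (P : CP2) : ℕ∞ :=
  MvPowerSeries.order
    ((MvPolynomial.bind₁ (fun i => MvPolynomial.X i + MvPolynomial.C (P.rep i)) F :
      MvPolynomial (Fin 3) ℂ) : MvPowerSeries (Fin 3) ℂ)

/-- `P` is a real point: it has real homogeneous coordinates. -/
def IsRealPoint (P : CP2) : Prop :=
  ∃ (v : Fin 3 → ℝ) (h : (fun i => (v i : ℂ)) ≠ 0), P = Projectivization.mk ℂ (fun i => (v i : ℂ)) h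

/-- The embedding of `ℂ = ℝ²` as the real affine points, `X + iY ↦ (X : Y : 1)`. -/
def affinePoint (z : ℂ) : CP2 :=
  Projectivization.mk ℂ ![(z.re : ℂ), (z.im : ℂ), 1] (fun h => one_ne_zero (congrFun h 2))

/-- The origin `(0 : 0 : 1)` of the affine plane. -/
def origin : CP2 := affinePoint 0

/-- The real affine points of the line dual to `P = (a : b : c)`, namely
`{X + iY : a X + b Y + c = 0}`. -/
def dualLine (P : CP2) : Set ℂ :=
  {z | Projectivization.orthogonal P (affinePoint z)}

/-! ### Base curve, boundary generating curve and seeds -/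

/-- `H₁ = Re A = (A + A*) / 2`. -/
def rePart {n : ℕ} (A : Matrix (Fin n) (Fin n) ℂ) : Matrix (Fin n) (Fin n) ℂ :=
  (1 / 2 : ℂ) • (A + A.conjTranspose)

/-- `H₂ = Im A = (A - A*) / (2 i)`. -/
def imPart {n : ℕ} (A : Matrix (Fin n) (Fin n) ℂ) : Matrix (Fin n) (Fin n) ℂ :=
  (1 / (2 * Complex.I) : ℂ) • (A - A.conjTranspose)

/-- The base polynomial `F_A(x, y, t) = det (x H₁ + y H₂ + t I)`. -/
def basePolynomial {n : ℕ} (A : Matrix (Fin n) (Fin n) ℂ) : MvPolynomial (Fin 3) ℂ :=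
  Matrix.det
    ((MvPolynomial.X 0 : MvPolynomial (Fin 3) ℂ) • (rePart A).map MvPolynomial.C
      + (MvPolynomial.X 1 : MvPolynomial (Fin 3) ℂ) • (imPart A).map MvPolynomial.C
      + (MvPolynomial.X 2 : MvPolynomial (Fin 3) ℂ) • (1 : Matrix (Fin n) (Fin n) _))

/-- The point set of the base curve `F_A = 0`. -/
def baseCurve {n : ℕ} (A : Matrix (Fin n) (Fin n) ℂ) : Set CP2 :=
  {P | MvPolynomial.eval P.rep (basePolynomial A) = 0}

/-- The boundary generating curve: the dual of the base curve. -/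
def boundaryGeneratingCurve {n : ℕ} (A : Matrix (Fin n) (Fin n) ℂ) : Set CP2 :=
  dualCurve (baseCurve A)

/-- `l` is a support line of `W`: a real line that meets `W` and has `W` on one side. -/
def IsSupportLine (W l : Set ℂ) : Prop :=
  ∃ a b c : ℝ, (a ≠ 0 ∨ b ≠ 0) ∧ l = {z : ℂ | a * z.re + b * z.im + c = 0} ∧
    (l ∩ W).Nonempty ∧ ∀ z ∈ W, 0 ≤ a * z.re + b * z.im + c

/-- A flat portion of `∂W(A)`: the intersection of `∂W(A)` with a support line, if it has more
than one point. -/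
def IsFlatPortion {n : ℕ} (A : Matrix (Fin n) (Fin n) ℂ) (S : Set ℂ) : Prop :=
  (∃ l, IsSupportLine (numericalRange A) l ∧ S = frontier (numericalRange A) ∩ l) ∧ S.Nontrivial

/-- A one-point set consisting of a point of `∂W(A)` that is a singular point of the boundary
generating curve. -/
def IsSingularSeed {n : ℕ} (A : Matrix (Fin n) (Fin n) ℂ) (S : Set ℂ) : Prop :=
  ∃ z ∈ frontier (numericalRange A),
    IsSingularPoint (boundaryGeneratingCurve A) (affinePoint z) ∧ S = {z}

/-- A seed of `A`. -/
def IsSeed {n : ℕ} (A : Matrix (Fin n) (Fin n) ℂ) (S : Set ℂ) : Prop :=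
  IsFlatPortion A S ∨ IsSingularSeed A S

/-- `P` is a real singularity of the base curve that corresponds to a seed of `A`: the line dual
to `P` is the support line of `W(A)` at a seed. -/
def IsSeedSingularity {n : ℕ} (A : Matrix (Fin n) (Fin n) ℂ) (P : CP2) : Prop :=
  IsRealPoint P ∧ 2 ≤ curveOrder (basePolynomial A) P ∧
    ∃ S, IsSeed A S ∧ IsSupportLine (numericalRange A) (dualLine P) ∧ S ⊆ dualLine P

end GauWu

end

open scoped LinearAlgebra.Projectivization ComplexConjugate

noncomputable section

namespace GauWu

/-!   apply Complex.ext
  · simp only [inner_add_right, inner_smul_right, h1, h2, Complex.add_im,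
      Complex.mul_im, Complex.I_re, Complex.I_im, Complex.ofReal_re]
    ring
  · simp only [h2, Complex.ofReal_im]
# The Toeplitz–Hausdorff theorem -/

section Convexity

variable {E : Type*} [NormedAddCommGroup E] [InnerProductSpace ℂ E]

/-! A real line has `W(A)` on one side exactly when, with the right sign, the Hermitian pencil at
its coefficient vector is positive semidefinite. Unit vectors giving boundary points are therefore
those killed by some positive semidefinite pencil (`exists_pencilOp_of_mem_frontier`,
`mem_frontier_of_pencilOp`).

Lower bound (`three_mem_boundarySystemSizes`): order at least 2 at a real point forces corank at
least 2. A seed singularity thus gives two orthonormal vectors on its support line, and an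
eigenvector of the largest eigenvalue of the same pencil lies on the opposite parallel support line.

Upper bound: suppose a whole orthonormal basis gives boundary points. Basis vectors with
non-parallel support lines are not coupled by `A`, so irreducibility makes all the lines parallel.
Only two parallel support lines exist, so after scaling one pencil is an orthogonal projection
diagonal in that basis (`exists_projection_of_full_system`). Its kernel and its range are the
kernels of the pencils at `v` and at `(0,0,1) - v`, two points collinear with the origin. A kernel
of dimension 2 or 3 always yields a seed singularity (`isSeedSingularity_of_projection`) of order at
least that dimension. Dimension 3 contradicts order 2, so both kernels are planes, which contradicts
the non-collinearity.

The hard point is a kernel of dimension 2 whose support line meets `W(A)` in a single point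
(`isSingularPoint_of_corank_two`). Near `v` the base curve then has two branches tangent to each
other with distinct nonzero second-order coefficients, by irreducibility. Dually there are two
tangent branches of distinct curvature through the contact point, and a form vanishing on both has
zero gradient there (`grad_eq_zero_of_tacnode`). -/

theorem inner_map_smul_self (T : E →ₗ[ℂ] E) (c : ℂ) (x : E) :
    inner ℂ (c • x) (T (c • x)) = (‖c‖ ^ 2 : ℝ) * inner ℂ x (T x) := by
  rw [map_smul, inner_smul_left, inner_smul_right, ← mul_assoc, Complex.conj_mul']
  push_cast; rfl

theorem exists_unimodular_rotation (w : ℂ) : ∃ c : ℂ, ‖c‖ = 1 ∧ (conj c * w).im = 0 := by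
  by_cases hw : w = 0
  · exact ⟨1, by simp, by simp [hw]⟩
  · have hn : (‖w‖ : ℂ) ≠ 0 := by simpa using hw
    refine ⟨w / ‖w‖, by simp [hw], ?_⟩
    have : conj (w / ‖w‖) * w = (‖w‖ : ℂ) := by
      rw [map_div₀, Complex.conj_ofReal, div_mul_eq_mul_div, Complex.conj_mul']
      field_simp
    rw [this, Complex.ofReal_im]

theorem exists_unit_of_inner_map_eq_mul (T : E →ₗ[ℂ] E) {v : E} (hv : v ≠ 0) {z : ℂ}
    (h : inner ℂ v (T v) = z * (‖v‖ ^ 2 : ℝ)) : ∃ u : E, ‖u‖ = 1 ∧ inner ℂ u (T u) = z := by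
  have hn : ‖v‖ ≠ 0 := norm_ne_zero_iff.mpr hv
  have hn' : (‖v‖ : ℂ) ≠ 0 := by exact_mod_cast hn
  refine ⟨((‖v‖⁻¹ : ℝ) : ℂ) • v, ?_, ?_⟩
  · rw [norm_smul, Complex.norm_real, norm_inv, norm_norm, inv_mul_cancel₀ hn]
  · rw [inner_map_smul_self, h, Complex.norm_real, norm_inv, norm_norm]
    push_cast
    field_simp

/-- After a change of phase of `x`, the form is real along the segment from `c • x` to `y`. The
normalised value runs from 0 to 1, so the intermediate value theorem applies to the equation with
the norm cleared from the denominator. -/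
theorem exists_unit_inner_map_eq_of_zero_one (T : E →ₗ[ℂ] E) {x y : E} (hx : ‖x‖ = 1)
    (hy : ‖y‖ = 1) (hTx : inner ℂ x (T x) = 0) (hTy : inner ℂ y (T y) = 1) {t : ℝ}
    (ht0 : 0 ≤ t) (ht1 : t ≤ 1) : ∃ u : E, ‖u‖ = 1 ∧ inner ℂ u (T u) = t := by
  -- The phase `c` is chosen to make the cross term `m` real: its imaginary part is that of `conj c`
  -- times the difference written here.
  obtain ⟨c, hc, hcim⟩ :=
    exists_unimodular_rotation (inner ℂ x (T y) - conj (inner ℂ y (T x)))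
  set m : ℂ := conj c * inner ℂ x (T y) + c * inner ℂ y (T x) with hm
  have hmim : m.im = 0 := by
    rw [← hcim, hm]
    simp only [Complex.add_im, Complex.mul_im, Complex.sub_im, Complex.sub_re, Complex.conj_re,
      Complex.conj_im]
    ring
  have hmre : ((m.re : ℝ) : ℂ) = m := Complex.ext (by simp) (by simp [hmim])
  set ρ : ℝ := (inner ℂ (c • x) y).re with hρ
  have hval : ∀ s : ℝ, inner ℂ (((1 - s : ℝ) : ℂ) • c • x + (s : ℂ) • y)
      (T (((1 - s : ℝ) : ℂ) • c • x + (s : ℂ) • y)) = ((s ^ 2 + s * (1 - s) * m.re : ℝ) : ℂ) := by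
    intro s
    have h1 : inner ℂ (c • x) (T (c • x)) = 0 := by rw [inner_map_smul_self, hTx, mul_zero]
    push_cast
    rw [hmre, hm]
    simp only [map_add, map_smul, inner_add_left, inner_add_right, inner_smul_left,
      inner_smul_right, hTx, hTy, map_sub, map_one, Complex.conj_ofReal]
    ring
  have hnorm : ∀ s : ℝ, ‖((1 - s : ℝ) : ℂ) • c • x + (s : ℂ) • y‖ ^ 2
      = (1 - s) ^ 2 + s ^ 2 + 2 * s * (1 - s) * ρ := by
    intro s
    rw [@norm_add_sq ℂ, norm_smul, norm_smul, norm_smul, hc, hx, hy, inner_smul_left,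
      inner_smul_right]
    simp only [Complex.conj_ofReal, Complex.norm_real, Real.norm_eq_abs, mul_one, sq_abs,
      RCLike.re_to_complex, Complex.re_ofReal_mul, ← hρ]
    ring
  have hcont : ContinuousOn (fun s : ℝ => s ^ 2 + s * (1 - s) * m.re
      - t * ((1 - s) ^ 2 + s ^ 2 + 2 * s * (1 - s) * ρ)) (Set.Icc 0 1) := by fun_prop
  obtain ⟨s, -, hs⟩ := intermediate_value_Icc zero_le_one hcont
    (show (0 : ℝ) ∈ Set.Icc _ _ by constructor <;> norm_num <;> linarith)
  refine exists_unit_of_inner_map_eq_mul T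
    (v := ((1 - s : ℝ) : ℂ) • c • x + (s : ℂ) • y) ?_ ?_
  -- If the vector vanished, `s • y` would be a multiple of `x`, on which the form is zero; then `s
  -- = 0`, and `c • x` would be zero.
  · intro h0
    have e1 : (s : ℂ) • y = (-(1 - s : ℝ) : ℂ) • c • x := by
      rw [neg_smul]; exact eq_neg_of_add_eq_zero_right h0
    have e2 : inner ℂ ((s : ℂ) • y) (T ((s : ℂ) • y)) = 0 := by
      rw [e1, inner_map_smul_self, inner_map_smul_self, hTx, mul_zero, mul_zero]
    rw [inner_map_smul_self, hTy, mul_one] at e2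
    have hs0 : s = 0 := by simpa using e2
    subst hs0
    have : ‖c • x‖ = 0 := by simpa using congrArg norm h0
    rw [norm_smul, hc, hx] at this
    norm_num at this
  · rw [hval, hnorm]
    simp only at hs
    rw [← Complex.ofReal_mul]
    congr 1
    linarith

/-- The **Toeplitz–Hausdorff theorem**: the values of `⟨x, T x⟩` on the unit sphere form a convex
set. -/
theorem convex_setOf_inner_map (T : E →ₗ[ℂ] E) :
    Convex ℝ {z : ℂ | ∃ x : E, ‖x‖ = 1 ∧ inner ℂ x (T x) = z} := by
  rintro _ ⟨x, hx, rfl⟩ _ ⟨y, hy, rfl⟩ a b ha hb hab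
  set z := inner ℂ x (T x) with hz
  set w := inner ℂ y (T y) with hw
  by_cases hzw : w - z = 0
  · refine ⟨x, hx, ?_⟩
    rw [sub_eq_zero.mp hzw, ← add_smul, hab, one_smul]
  -- An affine change of the operator moves the two given values to 0 and 1.
  set B : E →ₗ[ℂ] E := (w - z)⁻¹ • (T - z • LinearMap.id) with hB
  have hBval : ∀ u : E, ‖u‖ = 1 → inner ℂ u (B u) = (w - z)⁻¹ * (inner ℂ u (T u) - z) := by
    intro u hu
    simp [hB, hu]
  obtain ⟨u, hu, hub⟩ := exists_unit_inner_map_eq_of_zero_one B hx hy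
    (by rw [hBval x hx, ← hz, sub_self, mul_zero])
    (by rw [hBval y hy, ← hw, inv_mul_cancel₀ hzw]) hb (by linarith)
  refine ⟨u, hu, ?_⟩
  rw [hBval u hu] at hub
  have hab' : (a : ℂ) = 1 - b := by rw [eq_sub_iff_add_eq]; exact_mod_cast hab
  rw [inv_mul_eq_iff_eq_mul₀ hzw] at hub
  simp only [Complex.real_smul, hab']
  linear_combination hub

end Convexity

theorem convex_numericalRange {n : ℕ} (A : Matrix (Fin n) (Fin n) ℂ) :
    Convex ℝ (numericalRange A) :=
  convex_setOf_inner_map _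

/-- In finite dimension a convex set has a supporting functional at each point outside its
interior. -/
theorem _root_.Convex.exists_ne_zero_forall_le_of_notMem_interior {E : Type*}
    [NormedAddCommGroup E] [NormedSpace ℝ E] [FiniteDimensional ℝ E] {s : Set E}
    (hs : Convex ℝ s) {z : E} (hz : z ∈ s) (hzi : z ∉ interior s) :
    ∃ f : E →ₗ[ℝ] ℝ, f ≠ 0 ∧ ∀ w ∈ s, f w ≤ f z := by
  by_cases hne : (interior s).Nonempty
  · obtain ⟨f, hf, h⟩ := geometric_hahn_banach_of_nonempty_interior_point hs hzi hne
    refine ⟨f, fun h0 => hf ?_, h⟩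
    ext w
    exact congrArg (fun g : E →ₗ[ℝ] ℝ => g w) h0
  -- With empty interior the affine span is proper, and a functional killing its direction is
  -- constant on `s`.
  · rw [hs.interior_nonempty_iff_affineSpan_eq_top,
      ← AffineSubspace.direction_eq_top_iff_of_nonempty ⟨z, subset_affineSpan ℝ s hz⟩] at hne
    obtain ⟨f, hf, hle⟩ := Submodule.exists_le_ker_of_lt_top _ (lt_top_iff_ne_top.mpr hne)
    refine ⟨f, hf, fun w hw => le_of_eq ?_⟩
    have : w - z ∈ (affineSpan ℝ s).direction :=
      AffineSubspace.vsub_mem_direction (subset_affineSpan ℝ s hw) (subset_affineSpan ℝ s hz)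
    have h0 := hle this
    rwa [LinearMap.mem_ker, map_sub, sub_eq_zero] at h0

/-!   apply Complex.ext
  · simp only [inner_add_right, inner_smul_right, h1, h2, Complex.add_im,
      Complex.mul_im, Complex.I_re, Complex.I_im, Complex.ofReal_re]
    ring
  · simp only [h2, Complex.ofReal_im]
# The pencil of a matrix -/

/-- The pencil `x H₁ + y H₂ + t I`. -/
def pencil {n : ℕ} (A : Matrix (Fin n) (Fin n) ℂ) (v : Fin 3 → ℂ) : Matrix (Fin n) (Fin n) ℂ :=
  v 0 • rePart A + v 1 • imPart A + v 2 • 1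

/-- The complex vector underlying a real vector. -/
abbrev complexify (v : Fin 3 → ℝ) : Fin 3 → ℂ := fun i => (v i : ℂ)

/-- The operator of the pencil at a real point. -/
def pencilOp {n : ℕ} (A : Matrix (Fin n) (Fin n) ℂ) (v : Fin 3 → ℝ) :
    EuclideanSpace ℂ (Fin n) →ₗ[ℂ] EuclideanSpace ℂ (Fin n) :=
  Matrix.toEuclideanLin (pencil A (complexify v))

/-! ### Support lines as positive semidefinite pencils with a kernel -/

section Pencil

variable {n : ℕ} (A : Matrix (Fin n) (Fin n) ℂ)

theorem eval_basePolynomial (v : Fin 3 → ℂ) :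
    MvPolynomial.eval v (basePolynomial A) = (pencil A v).det := by
  rw [basePolynomial, RingHom.map_det]
  congr 1
  ext i j
  by_cases hij : i = j <;> simp [pencil, hij]

theorem pencil_add (v w : Fin 3 → ℂ) : pencil A (v + w) = pencil A v + pencil A w := by
  simp only [pencil, Pi.add_apply, add_smul]; abel

theorem pencil_smul (c : ℂ) (v : Fin 3 → ℂ) : pencil A (c • v) = c • pencil A v := by
  simp only [pencil, Pi.smul_apply, smul_eq_mul, mul_smul, smul_add]

theorem isHermitian_rePart : (rePart A).IsHermitian := by
  rw [Matrix.IsHermitian, rePart, Matrix.conjTranspose_smul, Matrix.conjTranspose_add,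
    Matrix.conjTranspose_conjTranspose, add_comm]
  simp

theorem isHermitian_imPart : (imPart A).IsHermitian := by
  rw [Matrix.IsHermitian, imPart, Matrix.conjTranspose_smul, Matrix.conjTranspose_sub,
    Matrix.conjTranspose_conjTranspose, ← neg_sub A, smul_neg, ← neg_smul]
  congr 1
  simp

theorem isHermitian_pencil (v : Fin 3 → ℝ) : (pencil A (complexify v)).IsHermitian := by
  rw [Matrix.IsHermitian, pencil]
  simp only [Matrix.conjTranspose_add, Matrix.conjTranspose_smul, Matrix.conjTranspose_one,
    (isHermitian_rePart A).eq, (isHermitian_imPart A).eq, complexify, RCLike.star_def,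
    Complex.conj_ofReal]

theorem rePart_add_imPart : rePart A + Complex.I • imPart A = A := by
  rw [rePart, imPart, smul_smul]
  have : Complex.I * (1 / (2 * Complex.I)) = 1 / 2 := by
    field_simp [Complex.I_ne_zero]
  rw [this]
  ext i j
  simp
  ring

theorem pencilOp_isSymmetric (v : Fin 3 → ℝ) : (pencilOp A v).IsSymmetric :=
  Matrix.isSymmetric_toEuclideanLin_iff.mpr (isHermitian_pencil A v)

theorem pencilOp_add (v w : Fin 3 → ℝ) : pencilOp A (v + w) = pencilOp A v + pencilOp A w := by
  rw [pencilOp, pencilOp, pencilOp, ← map_add, ← pencil_add]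
  congr 2
  ext i
  simp [complexify]

theorem pencilOp_smul (r : ℝ) (v : Fin 3 → ℝ) :
    pencilOp A (r • v) = (r : ℂ) • pencilOp A v := by
  rw [pencilOp, pencilOp, ← map_smul, ← pencil_smul]
  congr 2
  ext i
  simp [complexify]

theorem pencilOp_apply (v : Fin 3 → ℝ) (x : EuclideanSpace ℂ (Fin n)) :
    pencilOp A v x = (v 0 : ℂ) • Matrix.toEuclideanLin (rePart A) x
      + (v 1 : ℂ) • Matrix.toEuclideanLin (imPart A) x + (v 2 : ℂ) • x := by
  simp only [pencilOp, pencil, map_add, map_smul, LinearMap.add_apply, LinearMap.smul_apply,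
    complexify, Matrix.toLpLin_one, LinearMap.id_apply]

theorem toEuclideanLin_apply_eq (x : EuclideanSpace ℂ (Fin n)) :
    Matrix.toEuclideanLin A x = Matrix.toEuclideanLin (rePart A) x
      + Complex.I • Matrix.toEuclideanLin (imPart A) x := by
  conv_lhs => rw [← rePart_add_imPart A]
  simp

theorem toEuclideanLin_conjTranspose_apply_eq (x : EuclideanSpace ℂ (Fin n)) :
    Matrix.toEuclideanLin A.conjTranspose x = Matrix.toEuclideanLin (rePart A) x
      - Complex.I • Matrix.toEuclideanLin (imPart A) x := by
  have : A.conjTranspose = rePart A - Complex.I • imPart A := by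
    conv_lhs => rw [← rePart_add_imPart A]
    rw [Matrix.conjTranspose_add, Matrix.conjTranspose_smul, (isHermitian_rePart A).eq,
      (isHermitian_imPart A).eq]
    simp [sub_eq_add_neg]
  rw [this]
  simp

theorem inner_rePart (x : EuclideanSpace ℂ (Fin n)) :
    inner ℂ x (Matrix.toEuclideanLin (rePart A) x)
      = ((inner ℂ x (Matrix.toEuclideanLin A x)).re : ℂ) := by
  have h1 := (Matrix.isSymmetric_toEuclideanLin_iff.mpr (isHermitian_rePart A)
    ).im_inner_self_apply x
  have h2 := (Matrix.isSymmetric_toEuclideanLin_iff.mpr (isHermitian_imPart A)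
    ).im_inner_self_apply x
  rw [RCLike.im_to_complex] at h1 h2
  rw [toEuclideanLin_apply_eq A]
  apply Complex.ext
  · simp only [inner_add_right, inner_smul_right, h2, Complex.add_re, Complex.mul_re,
      Complex.I_re, Complex.I_im, Complex.ofReal_re]
    ring
  · simp only [h1, Complex.ofReal_im]

theorem inner_imPart (x : EuclideanSpace ℂ (Fin n)) :
    inner ℂ x (Matrix.toEuclideanLin (imPart A) x)
      = ((inner ℂ x (Matrix.toEuclideanLin A x)).im : ℂ) := by
  have h1 := (Matrix.isSymmetric_toEuclideanLin_iff.mpr (isHermitian_rePart A)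
    ).im_inner_self_apply x
  have h2 := (Matrix.isSymmetric_toEuclideanLin_iff.mpr (isHermitian_imPart A)
    ).im_inner_self_apply x
  rw [RCLike.im_to_complex] at h1 h2
  rw [toEuclideanLin_apply_eq A]
  apply Complex.ext
  · simp only [inner_add_right, inner_smul_right, h1, h2, Complex.add_im,
      Complex.mul_im, Complex.I_re, Complex.I_im, Complex.ofReal_re]
    ring
  · simp only [h2, Complex.ofReal_im]

theorem inner_pencilOp_self (v : Fin 3 → ℝ) {x : EuclideanSpace ℂ (Fin n)} (hx : ‖x‖ = 1) :
    inner ℂ x (pencilOp A v x) = ((v 0 * (inner ℂ x (Matrix.toEuclideanLin A x)).re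
      + v 1 * (inner ℂ x (Matrix.toEuclideanLin A x)).im + v 2 : ℝ) : ℂ) := by
  rw [pencilOp_apply, inner_add_right, inner_add_right, inner_smul_right, inner_smul_right,
    inner_smul_right, inner_rePart, inner_imPart, inner_self_eq_norm_sq_to_K, hx]
  push_cast
  simp

/-- On unit vectors the quadratic form of the pencil is the affine function of the line evaluated on
`W(A)`; other vectors follow by scaling. -/
theorem pencilOp_isPositive_iff (v : Fin 3 → ℝ) :
    (pencilOp A v).IsPositive ↔ ∀ z ∈ numericalRange A, 0 ≤ v 0 * z.re + v 1 * z.im + v 2 := by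
  constructor
  · rintro h z ⟨x, hx, rfl⟩
    have := h.re_inner_nonneg_right x
    rwa [inner_pencilOp_self A v hx, RCLike.re_to_complex, Complex.ofReal_re] at this
  · refine fun h => ⟨pencilOp_isSymmetric A v, fun x => ?_⟩
    rw [pencilOp_isSymmetric A v]
    by_cases hx : x = 0
    · simp [hx]
    have hn : ‖x‖ ≠ 0 := norm_ne_zero_iff.mpr hx
    set u := ((‖x‖⁻¹ : ℝ) : ℂ) • x with hu
    have hu1 : ‖u‖ = 1 := by
      rw [hu, norm_smul, Complex.norm_real, norm_inv, norm_norm, inv_mul_cancel₀ hn]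
    have hxu : x = ((‖x‖ : ℝ) : ℂ) • u := by
      rw [hu, smul_smul, ← Complex.ofReal_mul, mul_inv_cancel₀ hn, Complex.ofReal_one, one_smul]
    rw [hxu, inner_map_smul_self, inner_pencilOp_self A v hu1, ← Complex.ofReal_mul,
      RCLike.re_to_complex, Complex.ofReal_re]
    exact mul_nonneg (sq_nonneg _) (h _ ⟨u, hu1, rfl⟩)

theorem pencilOp_apply_eq_zero_of_inner {v : Fin 3 → ℝ} (h : (pencilOp A v).IsPositive)
    {x : EuclideanSpace ℂ (Fin n)} (hx : inner ℂ x (pencilOp A v x) = 0) :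
    pencilOp A v x = 0 := by
  have hp := Matrix.isPositive_toEuclideanLin_iff.mp h
  have := (hp.dotProduct_mulVec_zero_iff x.ofLp).mp (by
    rw [EuclideanSpace.inner_eq_star_dotProduct, dotProduct_comm] at hx
    exact hx)
  rw [pencilOp, Matrix.toLpLin_apply, this]
  rfl

theorem mem_frontier_of_pencilOp {v : Fin 3 → ℝ} (hv : v 0 ≠ 0 ∨ v 1 ≠ 0)
    (h : (pencilOp A v).IsPositive) {x : EuclideanSpace ℂ (Fin n)} (hx : ‖x‖ = 1)
    (hx0 : pencilOp A v x = 0) :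
    inner ℂ x (Matrix.toEuclideanLin A x) ∈ frontier (numericalRange A) := by
  set z := inner ℂ x (Matrix.toEuclideanLin A x) with hz
  have hz0 : v 0 * z.re + v 1 * z.im + v 2 = 0 := by
    have := inner_pencilOp_self A v hx
    rw [hx0, inner_zero_right] at this
    exact_mod_cast this.symm
  have hpos : 0 < v 0 ^ 2 + v 1 ^ 2 := by
    rcases hv with h | h <;> positivity
  refine ⟨subset_closure ⟨x, hx, rfl⟩, fun hint => ?_⟩
  -- Moving from `z` against the normal `v 0 + v 1 * I` makes the affine function negative, so `z`
  -- cannot be interior.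
  have hcont : Filter.Tendsto (fun r : ℝ => z - (r : ℂ) * (v 0 + v 1 * Complex.I))
      (nhds 0) (nhds z) := by
    have : Continuous (fun r : ℝ => z - (r : ℂ) * (v 0 + v 1 * Complex.I)) := by fun_prop
    simpa using this.tendsto 0
  have hev := hcont (mem_interior_iff_mem_nhds.mp hint)
  have hev' : ∀ᶠ r : ℝ in nhdsWithin 0 (Set.Ioi 0),
      z - (r : ℂ) * (v 0 + v 1 * Complex.I) ∈ numericalRange A :=
    Filter.Eventually.filter_mono nhdsWithin_le_nhds hev
  obtain ⟨r, hr, hr0⟩ := (hev'.and self_mem_nhdsWithin).exists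
  have := (pencilOp_isPositive_iff A v).mp h _ hr
  simp at this
  have hr0' : 0 < r := hr0
  nlinarith [mul_pos hr0' hpos]

theorem exists_pencilOp_of_mem_frontier {x : EuclideanSpace ℂ (Fin n)} (hx : ‖x‖ = 1)
    (hf : inner ℂ x (Matrix.toEuclideanLin A x) ∈ frontier (numericalRange A)) :
    ∃ v : Fin 3 → ℝ, (v 0 ≠ 0 ∨ v 1 ≠ 0) ∧ (pencilOp A v).IsPositive ∧ pencilOp A v x = 0 := by
  set z := inner ℂ x (Matrix.toEuclideanLin A x) with hz
  obtain ⟨f, hf0, hle⟩ := (convex_numericalRange A).exists_ne_zero_forall_le_of_notMem_interior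
    ⟨x, hx, rfl⟩ hf.2
  have hfe : ∀ w : ℂ, f w = f 1 * w.re + f Complex.I * w.im := by
    intro w
    have : w = w.re • (1 : ℂ) + w.im • Complex.I := by
      simp [Complex.real_smul]
    conv_lhs => rw [this, map_add, map_smul, map_smul, smul_eq_mul, smul_eq_mul]
    ring
  -- The supporting inequality `f w ≤ f z` is the nonnegativity of the affine function with these
  -- coefficients.
  have hp : (pencilOp A ![-f 1, -f Complex.I, f z]).IsPositive := by
    rw [pencilOp_isPositive_iff]
    intro w hw
    have := hle w hw
    rw [hfe w] at this
    simp
    linarith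
  refine ⟨![-f 1, -f Complex.I, f z], ?_, hp, ?_⟩
  · by_contra hcon
    push Not at hcon
    simp at hcon
    apply hf0
    ext w
    rw [hfe w]
    simp [hcon]
  · apply pencilOp_apply_eq_zero_of_inner A hp
    rw [inner_pencilOp_self A _ hx, ← hz, hfe z]
    simp
    ring

end Pencil

/-! ### Reducing subspaces -/

/-- The matrix whose columns are the vectors of an orthonormal basis. -/
def columnMatrix {n : ℕ} (b : OrthonormalBasis (Fin n) ℂ (EuclideanSpace ℂ (Fin n))) :
    Matrix (Fin n) (Fin n) ℂ :=
  Matrix.of fun i j => b j i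

section Reducing

variable {n : ℕ} {A : Matrix (Fin n) (Fin n) ℂ}

theorem star_columnMatrix_mul_mul_apply
    (b : OrthonormalBasis (Fin n) ℂ (EuclideanSpace ℂ (Fin n))) (M : Matrix (Fin n) (Fin n) ℂ)
    (i j : Fin n) :
    (star (columnMatrix b) * M * columnMatrix b) i j
      = inner ℂ (b i) (Matrix.toEuclideanLin M (b j)) := by
  rw [EuclideanSpace.inner_eq_star_dotProduct, Matrix.mul_assoc, Matrix.mul_apply,
    dotProduct_comm, dotProduct]
  refine Finset.sum_congr rfl fun k _ => ?_
  simp [columnMatrix, Matrix.mul_apply, Matrix.mulVec, dotProduct]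

theorem star_columnMatrix_mul_self
    (b : OrthonormalBasis (Fin n) ℂ (EuclideanSpace ℂ (Fin n))) :
    star (columnMatrix b) * columnMatrix b = 1 := by
  ext i j
  have := star_columnMatrix_mul_mul_apply b 1 i j
  rw [Matrix.mul_one, Matrix.toLpLin_one, LinearMap.id_apply,
    orthonormal_iff_ite.mp b.orthonormal] at this
  rw [this, Matrix.one_apply]

theorem isUnitarilyReducible_of_orthonormalBasis
    (b : OrthonormalBasis (Fin n) ℂ (EuclideanSpace ℂ (Fin n))) (p : Fin n → Prop)
    (hp : ∃ i, p i) (hnp : ∃ i, ¬ p i)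
    (h : ∀ i j, p i → ¬ p j → inner ℂ (b i) (Matrix.toEuclideanLin A (b j)) = 0 ∧
      inner ℂ (b j) (Matrix.toEuclideanLin A (b i)) = 0) : IsUnitarilyReducible A := by
  classical
  set e : Fin (Fintype.card {i // p i}) ⊕ Fin (Fintype.card {i // ¬ p i}) ≃ Fin n :=
    ((Fintype.equivFin {i // p i}).symm.sumCongr (Fintype.equivFin {i // ¬ p i}).symm).trans
      (Equiv.sumCompl p) with he
  set M := star (columnMatrix b) * A * columnMatrix b with hM
  have hl : ∀ i, p (e (Sum.inl i)) := fun i => by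
    simpa [he] using ((Fintype.equivFin {i // p i}).symm i).2
  have hr : ∀ i, ¬ p (e (Sum.inr i)) := fun i => by
    simpa [he] using ((Fintype.equivFin {i // ¬ p i}).symm i).2
  refine ⟨_, _, Fintype.card_pos_iff.mpr ⟨⟨_, hp.choose_spec⟩⟩,
    Fintype.card_pos_iff.mpr ⟨⟨_, hnp.choose_spec⟩⟩, e,
    M.submatrix (e ∘ Sum.inl) (e ∘ Sum.inl), M.submatrix (e ∘ Sum.inr) (e ∘ Sum.inr),
    columnMatrix b, Matrix.mem_unitaryGroup_iff'.mpr (star_columnMatrix_mul_self b), ?_⟩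
  rw [← hM, ← Equiv.symm_apply_eq]
  ext (i | i) (j | j)
  · simp
  · simp [hM, star_columnMatrix_mul_mul_apply, (h _ _ (hl i) (hr j)).1]
  · simp [hM, star_columnMatrix_mul_mul_apply, (h _ _ (hl j) (hr i)).2]
  · simp

/-- Invariance under `A` and under its adjoint kills both off-diagonal blocks in an orthonormal
basis that extends one of `S`. -/
theorem isUnitarilyReducible_of_invariant (S : Submodule ℂ (EuclideanSpace ℂ (Fin n)))
    (hbot : S ≠ ⊥) (htop : S ≠ ⊤) (h : ∀ x ∈ S, Matrix.toEuclideanLin A x ∈ S)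
    (h' : ∀ x ∈ S, Matrix.toEuclideanLin A.conjTranspose x ∈ S) : IsUnitarilyReducible A := by
  classical
  set k := Module.finrank ℂ S with hk
  have hk0 : 0 < k := by
    rw [hk, Module.finrank_pos_iff]
    exact Submodule.nontrivial_iff_ne_bot.mpr hbot
  have hkn : k < n := by
    have := Submodule.finrank_lt htop
    simpa using this
  set s := stdOrthonormalBasis ℂ S with hs
  set v : Fin n → EuclideanSpace ℂ (Fin n) :=
    fun i => if hi : (i : ℕ) < k then (s ⟨i, hi⟩ : EuclideanSpace ℂ (Fin n)) else 0 with hv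
  have hvlt : ∀ (i : Fin n) (hi : (i : ℕ) < k), v i = s ⟨i, hi⟩ := fun i hi => by simp [hv, hi]
  have hon : Orthonormal ℂ (Set.domRestrict {i : Fin n | (i : ℕ) < k} v) := by
    have h1 : Orthonormal ℂ (fun i : Fin k => (s i : EuclideanSpace ℂ (Fin n))) :=
      s.orthonormal.comp_linearIsometry S.subtypeₗᵢ
    convert h1.comp (fun i : {i : Fin n | (i : ℕ) < k} => (⟨i.1, i.2⟩ : Fin k)) ?_ using 1
    · ext1 i
      exact hvlt i.1 i.2
    · intro i j hij
      simpa [Fin.ext_iff, Subtype.ext_iff] using hij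
  obtain ⟨b, hb⟩ := hon.exists_orthonormalBasis_extension_of_card_eq (by simp)
  have hbS : ∀ i : Fin n, (i : ℕ) < k → b i ∈ S := fun i hi => by
    rw [hb i hi, hvlt i hi]; exact (s _).2
  have hperp : ∀ j : Fin n, ¬ (j : ℕ) < k → ∀ x ∈ S, inner ℂ (b j) x = 0 := by
    intro j hj x hx
    have hsum := congrArg (Subtype.val) (s.sum_repr ⟨x, hx⟩)
    simp only [AddSubmonoidClass.coe_finsetSum, Submodule.coe_smul] at hsum
    rw [← hsum, inner_sum]
    refine Finset.sum_eq_zero fun m _ => ?_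
    have hm : (s m : EuclideanSpace ℂ (Fin n)) = b ⟨m, m.2.trans hkn⟩ := by
      rw [hb ⟨m, m.2.trans hkn⟩ m.2, hvlt _ m.2]
    have hne : j ≠ ⟨m, m.2.trans hkn⟩ := by
      rintro rfl
      exact hj m.2
    rw [inner_smul_right, hm, b.orthonormal.2 hne, mul_zero]
  refine isUnitarilyReducible_of_orthonormalBasis b (fun i => (i : ℕ) < k)
    ⟨⟨0, hk0.trans hkn⟩, hk0⟩ ⟨⟨k, hkn⟩, lt_irrefl k⟩ fun i j hi hj => ⟨?_, ?_⟩
  · have := hperp j hj _ (h' _ (hbS i hi))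
    rw [Matrix.toEuclideanLin_conjTranspose_eq_adjoint, LinearMap.adjoint_inner_right] at this
    rw [← inner_conj_symm, this, map_zero]
  · exact hperp j hj _ (h _ (hbS i hi))

/-- Two pencils with non-parallel linear parts determine `H₁` and `H₂` modulo the identity, by
Cramer's rule; invariance passes to these and hence to `A` and its adjoint. -/
theorem isUnitarilyReducible_of_pencilOp_invariant {v q : Fin 3 → ℝ}
    (hvq : v 0 * q 1 - v 1 * q 0 ≠ 0) (S : Submodule ℂ (EuclideanSpace ℂ (Fin n)))
    (hbot : S ≠ ⊥) (htop : S ≠ ⊤) (hv : ∀ x ∈ S, pencilOp A v x ∈ S)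
    (hq : ∀ x ∈ S, pencilOp A q x ∈ S) : IsUnitarilyReducible A := by
  have hd : ((v 0 * q 1 - v 1 * q 0 : ℝ) : ℂ) ≠ 0 := by exact_mod_cast hvq
  have hre : ∀ x ∈ S, Matrix.toEuclideanLin (rePart A) x ∈ S := by
    intro x hx
    have h1 : ((v 0 * q 1 - v 1 * q 0 : ℝ) : ℂ) • Matrix.toEuclideanLin (rePart A) x
        = (q 1 : ℂ) • pencilOp A v x - (v 1 : ℂ) • pencilOp A q x
          - ((q 1 * v 2 - v 1 * q 2 : ℝ) : ℂ) • x := by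
      rw [pencilOp_apply, pencilOp_apply]
      push_cast
      module
    rw [← Submodule.smul_mem_iff S hd, h1]
    exact S.sub_mem (S.sub_mem (S.smul_mem _ (hv x hx)) (S.smul_mem _ (hq x hx))) (S.smul_mem _ hx)
  have him : ∀ x ∈ S, Matrix.toEuclideanLin (imPart A) x ∈ S := by
    intro x hx
    have h1 : ((v 0 * q 1 - v 1 * q 0 : ℝ) : ℂ) • Matrix.toEuclideanLin (imPart A) x
        = (v 0 : ℂ) • pencilOp A q x - (q 0 : ℂ) • pencilOp A v x
          - ((v 0 * q 2 - q 0 * v 2 : ℝ) : ℂ) • x := by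
      rw [pencilOp_apply, pencilOp_apply]
      push_cast
      module
    rw [← Submodule.smul_mem_iff S hd, h1]
    exact S.sub_mem (S.sub_mem (S.smul_mem _ (hq x hx)) (S.smul_mem _ (hv x hx))) (S.smul_mem _ hx)
  refine isUnitarilyReducible_of_invariant S hbot htop (fun x hx => ?_) (fun x hx => ?_)
  · rw [toEuclideanLin_apply_eq A]
    exact S.add_mem (hre x hx) (S.smul_mem _ (him x hx))
  · rw [toEuclideanLin_conjTranspose_apply_eq A]
    exact S.sub_mem (hre x hx) (S.smul_mem _ (him x hx))

/-- A common invariant plane or line reduces a matrix of order at least `3`. -/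
theorem isUnitarilyReducible_of_span_pair (hn : 3 ≤ n) {v q : Fin 3 → ℝ}
    (hvq : v 0 * q 1 - v 1 * q 0 ≠ 0) {x y : EuclideanSpace ℂ (Fin n)} (hx : x ≠ 0)
    (hvx : pencilOp A v x ∈ Submodule.span ℂ {x, y})
    (hvy : pencilOp A v y ∈ Submodule.span ℂ {x, y})
    (hqx : pencilOp A q x ∈ Submodule.span ℂ {x, y})
    (hqy : pencilOp A q y ∈ Submodule.span ℂ {x, y}) : IsUnitarilyReducible A := by
  classical
  have key : ∀ T : EuclideanSpace ℂ (Fin n) →ₗ[ℂ] EuclideanSpace ℂ (Fin n),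
      T x ∈ Submodule.span ℂ {x, y} → T y ∈ Submodule.span ℂ {x, y} →
      ∀ z ∈ Submodule.span ℂ {x, y}, T z ∈ Submodule.span ℂ {x, y} := by
    intro T h1 h2 z hz
    obtain ⟨a, b, rfl⟩ := Submodule.mem_span_pair.mp hz
    rw [map_add, map_smul, map_smul]
    exact Submodule.add_mem _ (Submodule.smul_mem _ _ h1) (Submodule.smul_mem _ _ h2)
  refine isUnitarilyReducible_of_pencilOp_invariant hvq (Submodule.span ℂ {x, y}) ?_ ?_
    (key _ hvx hvy) (key _ hqx hqy)
  · exact fun h => hx ((Submodule.span_eq_bot.mp h) x (by simp))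
  · intro h
    have h1 : Module.finrank ℂ (Submodule.span ℂ ((({x, y} : Finset (EuclideanSpace ℂ (Fin n))) :
        Set (EuclideanSpace ℂ (Fin n))))) ≤ 2 :=
      (finrank_span_finset_le_card _).trans Finset.card_le_two
    rw [Finset.coe_pair, h, finrank_top, finrank_euclideanSpace_fin] at h1
    omega

/-- If the pencil of a matrix of order at least `3` vanishes at a real point other than
`(0 : 0 : 1)`, then the matrix is unitarily reducible. -/
theorem isUnitarilyReducible_of_pencilOp_eq_zero (hn : 3 ≤ n) {v : Fin 3 → ℝ}
    (hv : v 0 ≠ 0 ∨ v 1 ≠ 0) (h : pencilOp A v = 0) : IsUnitarilyReducible A := by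
  have hd : v 0 * v 0 - v 1 * -v 1 ≠ 0 := by
    rcases hv with h | h
    · nlinarith [sq_nonneg (v 1), sq_pos_of_ne_zero h]
    · nlinarith [sq_nonneg (v 0), sq_pos_of_ne_zero h]
  have : Nontrivial (EuclideanSpace ℂ (Fin n)) := by
    have : Nonempty (Fin n) := ⟨⟨0, by omega⟩⟩
    infer_instance
  -- An eigenvector of any non-parallel pencil spans a line that the zero pencil also preserves; the
  -- quarter turn of `v` is such a pencil.
  obtain ⟨μ, hμ⟩ := Module.End.exists_eigenvalue (pencilOp A ![-v 1, v 0, 0])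
  obtain ⟨x, hx⟩ := hμ.exists_hasEigenvector
  refine isUnitarilyReducible_of_span_pair hn (q := ![-v 1, v 0, 0]) (x := x) (y := x) hd hx.2
    ?_ ?_ ?_ ?_
  · simp [h]
  · simp [h]
  all_goals
    rw [hx.apply_eq_smul]
    exact Submodule.smul_mem _ _ (Submodule.subset_span (by simp))

end Reducing

/-! ### The order of the base curve at a real point -/

/-- A column of power series without constant term raises the order of the determinant by one. -/
theorem card_le_order_det {σ R ι : Type*} [CommRing R] [Fintype ι] [DecidableEq ι]
    (M : Matrix ι ι (MvPowerSeries σ R)) (S : Finset ι)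
    (h : ∀ j ∈ S, ∀ i, MvPowerSeries.constantCoeff (M i j) = 0) :
    (S.card : ℕ∞) ≤ M.det.order := by
  apply MvPowerSeries.nat_le_order
  intro d hd
  rw [Matrix.det_apply', map_sum]
  refine Finset.sum_eq_zero fun τ _ => MvPowerSeries.coeff_of_lt_order ?_
  have h1 : (S.card : ℕ∞) ≤ ∑ i, (M (τ i) i).order := by
    calc (S.card : ℕ∞) = ∑ i ∈ S, 1 := by simp
      _ ≤ ∑ i ∈ S, (M (τ i) i).order := Finset.sum_le_sum fun i hi =>
          MvPowerSeries.one_le_order_iff_constCoeff_eq_zero.mpr (h i hi _)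
      _ ≤ ∑ i, (M (τ i) i).order :=
          Finset.sum_le_sum_of_subset_of_nonneg (Finset.subset_univ _) fun _ _ _ => zero_le
  have h2 : (S.card : ℕ∞) ≤ (((Equiv.Perm.sign τ : ℤ) : MvPowerSeries σ R)
      * ∏ i, M (τ i) i).order :=
    h1.trans ((MvPowerSeries.le_order_prod _ _).trans
      (le_add_self.trans MvPowerSeries.le_order_mul))
  exact lt_of_lt_of_le (by exact_mod_cast hd) h2

/-- Translation of a polynomial to a point, as a power series. -/
def taylorHom (r : Fin 3 → ℂ) : MvPolynomial (Fin 3) ℂ →+* MvPowerSeries (Fin 3) ℂ :=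
  MvPolynomial.coeToMvPowerSeries.ringHom.comp
    (MvPolynomial.bind₁ (fun i => MvPolynomial.X i + MvPolynomial.C (r i)) :
      MvPolynomial (Fin 3) ℂ →ₐ[ℂ] MvPolynomial (Fin 3) ℂ).toRingHom

theorem curveOrder_eq_order_taylorHom (F : MvPolynomial (Fin 3) ℂ) (P : CP2) :
    curveOrder F P = (taylorHom P.rep F).order := rfl

theorem constantCoeff_taylorHom (r : Fin 3 → ℂ) (F : MvPolynomial (Fin 3) ℂ) :
    MvPowerSeries.constantCoeff (taylorHom r F) = MvPolynomial.eval r F := by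
  have : (MvPowerSeries.constantCoeff (σ := Fin 3) (R := ℂ)).comp (taylorHom r)
      = MvPolynomial.eval r := by
    apply MvPolynomial.ringHom_ext
    · intro a
      simp [taylorHom]
    · intro i
      simp [taylorHom]
  exact congrArg (fun f => f F) this

section CurveOrder

variable {n : ℕ} {A : Matrix (Fin n) (Fin n) ℂ}

/-- Multiplying the Taylor-expanded pencil on the right by the unitary matrix of `b` gives one
column without constant term for each kernel vector. The unitary determinant is an invertible
constant, so the order of the determinant is not affected. -/
theorem card_le_curveOrder (b : OrthonormalBasis (Fin n) ℂ (EuclideanSpace ℂ (Fin n)))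
    (S : Finset (Fin n)) {P : CP2}
    (h : ∀ j ∈ S, Matrix.toEuclideanLin (pencil A P.rep) (b j) = 0) :
    (S.card : ℕ∞) ≤ curveOrder (basePolynomial A) P := by
  set ψ := taylorHom P.rep with hψ
  set N : Matrix (Fin n) (Fin n) (MvPolynomial (Fin 3) ℂ) :=
    ((MvPolynomial.X 0 : MvPolynomial (Fin 3) ℂ) • (rePart A).map MvPolynomial.C
      + (MvPolynomial.X 1 : MvPolynomial (Fin 3) ℂ) • (imPart A).map MvPolynomial.C
      + (MvPolynomial.X 2 : MvPolynomial (Fin 3) ℂ) • (1 : Matrix (Fin n) (Fin n) _)) with hN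
  set U := columnMatrix b with hU
  have hconst : ∀ i j, MvPowerSeries.constantCoeff (ψ.mapMatrix N i j) = pencil A P.rep i j := by
    intro i j
    rw [RingHom.mapMatrix_apply, Matrix.map_apply, hψ, constantCoeff_taylorHom, hN]
    by_cases hij : i = j <;> simp [pencil, hij]
  have hle : (S.card : ℕ∞) ≤ (ψ.mapMatrix N
      * (MvPowerSeries.C (σ := Fin 3) (R := ℂ)).mapMatrix U).det.order := by
    apply card_le_order_det
    intro j hj i
    have := congrArg (fun x : EuclideanSpace ℂ (Fin n) => x i) (h j hj)
    simp only [Matrix.toLpLin_apply, Matrix.mulVec, dotProduct, PiLp.zero_apply] at this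
    rw [Matrix.mul_apply, map_sum, ← this]
    refine Finset.sum_congr rfl fun k _ => ?_
    rw [map_mul, hconst]
    simp [hU, columnMatrix]
  have hdet : U.det * (star U).det = 1 := by
    rw [mul_comm, ← Matrix.det_mul, star_columnMatrix_mul_self, Matrix.det_one]
  have hF : ψ (basePolynomial A) = (ψ.mapMatrix N
      * (MvPowerSeries.C (σ := Fin 3) (R := ℂ)).mapMatrix U).det
      * MvPowerSeries.C (star U).det := by
    rw [Matrix.det_mul, ← RingHom.map_det, ← RingHom.map_det, mul_assoc, ← map_mul, hdet, map_one,
      mul_one]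
    rfl
  rw [curveOrder_eq_order_taylorHom, ← hψ, hF]
  exact hle.trans (le_self_add.trans MvPowerSeries.le_order_mul)

/-- Restriction to a line through the origin cannot lower the order of vanishing. -/
theorem X_sq_dvd_aeval_of_two_le_order {σ : Type*} [Fintype σ] {G : MvPolynomial σ ℂ}
    (h : 2 ≤ (G : MvPowerSeries σ ℂ).order) (w : σ → ℂ) :
    (Polynomial.X : Polynomial ℂ) ^ 2 ∣
      MvPolynomial.aeval (fun i => Polynomial.C (w i) * Polynomial.X) G := by
  rw [MvPolynomial.aeval_def, MvPolynomial.eval₂_eq]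
  refine Finset.dvd_sum fun d hd => Dvd.dvd.mul_left ?_ _
  have hdeg : 2 ≤ d.degree := by
    have h1 : MvPowerSeries.coeff d (G : MvPowerSeries σ ℂ) ≠ 0 := by
      rw [MvPolynomial.coeff_coe]
      exact MvPolynomial.mem_support_iff.mp hd
    exact_mod_cast h.trans (MvPowerSeries.order_le h1)
  have : ∏ i ∈ d.support, (Polynomial.C (w i) * Polynomial.X) ^ d i
      = (∏ i ∈ d.support, Polynomial.C (w i) ^ d i) * Polynomial.X ^ d.degree := by
    simp_rw [mul_pow]
    rw [Finset.prod_mul_distrib, Finset.prod_pow_eq_pow_sum]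
    rfl
  rw [this]
  exact Dvd.dvd.mul_left (pow_dvd_pow _ hdeg) _

theorem exists_ne_of_X_sq_dvd_prod {ι K : Type*} [Fintype ι] [DecidableEq ι] [Field K] (l : ι → K)
    (h : (Polynomial.X : Polynomial K) ^ 2 ∣ ∏ i, (Polynomial.X + Polynomial.C (l i))) :
    ∃ i j, i ≠ j ∧ l i = 0 ∧ l j = 0 := by
  have hz : ∀ a : K, (Polynomial.X : Polynomial K) ∣ Polynomial.X + Polynomial.C a → a = 0 := by
    intro a ha
    rw [Polynomial.X_dvd_iff] at ha
    simpa using ha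
  obtain ⟨i, -, hi⟩ := (Polynomial.prime_X.dvd_finsetProd_iff _).mp
    ((dvd_pow_self _ two_ne_zero).trans h)
  rw [← Finset.mul_prod_erase _ _ (Finset.mem_univ i), hz _ hi, map_zero, add_zero, sq] at h
  obtain ⟨j, hj, hj'⟩ := (Polynomial.prime_X.dvd_finsetProd_iff _).mp
    ((mul_dvd_mul_iff_left Polynomial.X_ne_zero).mp h)
  exact ⟨i, j, (Finset.ne_of_mem_erase hj).symm, hz _ hi, hz _ hj'⟩

theorem det_add_smul_one {M : Matrix (Fin n) (Fin n) ℂ} (hM : M.IsHermitian) (s : ℂ) :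
    (M + s • 1).det = ∏ i, (s + (hM.eigenvalues i : ℂ)) := by
  have h1 := Matrix.eval_charpoly M (-s)
  rw [hM.charpoly_eq, Polynomial.eval_prod] at h1
  have h2 : M + s • 1 = -(Matrix.scalar (Fin n) (-s) - M) := by
    ext i j
    by_cases hij : i = j <;> simp [Matrix.scalar_apply, hij]
  rw [h2, Matrix.det_neg, ← h1, Fintype.card_fin]
  have h3 : ((-1 : ℂ)) ^ n = ∏ _i : Fin n, (-1 : ℂ) := by simp
  rw [h3, ← Finset.prod_mul_distrib]
  refine Finset.prod_congr rfl fun i _ => ?_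
  simp
  ring

/-- In the direction `(0,0,1)` the pencil changes by multiples of the identity. The restricted
polynomial is then, up to a nonzero constant, the product of `s + λ` over the eigenvalues `λ`, and a
double zero at `s = 0` needs two zero eigenvalues. -/
theorem exists_eigenvalues_eq_zero_of_two_le_curveOrder {v : Fin 3 → ℝ} {c : ℂ} (hc : c ≠ 0)
    {P : CP2} (hP : P.rep = c • complexify v)
    (h : 2 ≤ curveOrder (basePolynomial A) P) :
    ∃ i j, i ≠ j ∧ (isHermitian_pencil A v).eigenvalues i = 0 ∧
      (isHermitian_pencil A v).eigenvalues j = 0 := by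
  set G : MvPolynomial (Fin 3) ℂ :=
    MvPolynomial.bind₁ (fun i => MvPolynomial.X i + MvPolynomial.C (P.rep i)) (basePolynomial A)
    with hG
  -- The direction carries the factor `c` so that the representative `c • v` can be pulled out of
  -- the whole pencil.
  have hdvd := X_sq_dvd_aeval_of_two_le_order (G := G) h ![0, 0, c]
  set p := MvPolynomial.aeval
    (fun i => Polynomial.C ((![0, 0, c] : Fin 3 → ℂ) i) * Polynomial.X) G with hp
  have hpe : p = Polynomial.C (c ^ n) * ∏ i, (Polynomial.X
      + Polynomial.C ((isHermitian_pencil A v).eigenvalues i : ℂ)) := by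
    apply Polynomial.funext
    intro s
    have h1 : p.eval s = MvPolynomial.eval (c • (complexify v + s • ![0, 0, 1]))
        (basePolynomial A) := by
      rw [hp, hG, ← Polynomial.coe_evalRingHom, MvPolynomial.map_aeval, MvPolynomial.eval₂Hom_bind₁,
        MvPolynomial.eval, MvPolynomial.coe_eval₂Hom, MvPolynomial.coe_eval₂Hom]
      congr 1
      · ext a; simp
      · funext i
        rw [hP]
        fin_cases i
        · simp [Matrix.vecHead]
        · simp [Matrix.vecHead, Matrix.vecTail]
        · simp [Matrix.vecHead, Matrix.vecTail]
          ring
    have h2 : pencil A (s • ![0, 0, 1]) = s • 1 := by simp [pencil]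
    rw [h1, eval_basePolynomial, pencil_smul, pencil_add, h2, Matrix.det_smul,
      det_add_smul_one (isHermitian_pencil A v), Fintype.card_fin, Polynomial.eval_mul,
      Polynomial.eval_C, Polynomial.eval_prod]
    simp
  rw [hpe] at hdvd
  have hu : IsUnit (Polynomial.C (c ^ n)) :=
    Polynomial.isUnit_C.mpr (isUnit_iff_ne_zero.mpr (pow_ne_zero _ hc))
  rw [hu.dvd_mul_left] at hdvd
  obtain ⟨i, j, hij, hi, hj⟩ := exists_ne_of_X_sq_dvd_prod _ hdvd
  exact ⟨i, j, hij, by exact_mod_cast hi, by exact_mod_cast hj⟩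

end CurveOrder

/-! ### Expansions of ternary forms -/

theorem eval_smul_of_isHomogeneous {σ R : Type*} [CommSemiring R] {G : MvPolynomial σ R} {d : ℕ}
    (hG : G.IsHomogeneous d) (c : R) (w : σ → R) :
    MvPolynomial.eval (c • w) G = c ^ d * MvPolynomial.eval w G := by
  rw [MvPolynomial.eval_eq, MvPolynomial.eval_eq, Finset.mul_sum]
  refine Finset.sum_congr rfl fun m hm => ?_
  have hdeg : ∑ i ∈ m.support, m i = d := (hG.degree_eq_sum_deg_support hm).symm
  simp only [Pi.smul_apply, smul_eq_mul, mul_pow]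
  rw [Finset.prod_mul_distrib, Finset.prod_pow_eq_pow_sum, hdeg]
  ring

theorem grad_smul_of_isHomogeneous {G : MvPolynomial (Fin 3) ℂ} {d : ℕ}
    (hG : G.IsHomogeneous d) (c : ℂ) (w : Fin 3 → ℂ) :
    grad G (c • w) = c ^ (d - 1) • grad G w := by
  funext i
  exact eval_smul_of_isHomogeneous hG.pderiv c w

theorem grad_dotProduct_self_of_isHomogeneous {G : MvPolynomial (Fin 3) ℂ} {d : ℕ}
    (hG : G.IsHomogeneous d) (w : Fin 3 → ℂ) :
    grad G w ⬝ᵥ w = d * MvPolynomial.eval w G := by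
  have := congrArg (MvPolynomial.eval w) hG.sum_X_mul_pderiv
  rw [map_sum, map_nsmul, nsmul_eq_mul] at this
  rw [← this, dotProduct]
  refine Finset.sum_congr rfl fun i _ => ?_
  rw [map_mul, MvPolynomial.eval_X, mul_comm]
  rfl

theorem grad_add (G H : MvPolynomial (Fin 3) ℂ) (w : Fin 3 → ℂ) :
    grad (G + H) w = grad G w + grad H w := by
  funext i
  simp [grad]

theorem grad_mul_X (G : MvPolynomial (Fin 3) ℂ) (k : Fin 3) (w : Fin 3 → ℂ) :
    grad (G * MvPolynomial.X k) w
      = w k • grad G w + MvPolynomial.eval w G • Pi.single k 1 := by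
  funext i
  by_cases hik : i = k
  · subst hik
    simp [grad, mul_comm, add_comm]
  · simp [grad, MvPolynomial.pderiv_X_of_ne (Ne.symm hik), hik, mul_comm]

/-- The derivative of a polynomial along a line. -/
theorem hasDerivAt_eval_line (G : MvPolynomial (Fin 3) ℂ) (w u : Fin 3 → ℂ) :
    HasDerivAt (fun k : ℂ => MvPolynomial.eval (w + k • u) G) (grad G w ⬝ᵥ u) 0 := by
  induction G using MvPolynomial.induction_on with
  | C a => simpa [grad, dotProduct] using hasDerivAt_const (0 : ℂ) a
  | add p q hp hq =>
    rw [grad_add, add_dotProduct]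
    simpa using! hp.add hq
  | mul_X p i hp =>
    have hl : HasDerivAt (fun k : ℂ => w i + k * u i) (u i) 0 := by
      simpa using! ((hasDerivAt_id (0 : ℂ)).mul_const (u i)).const_add (w i)
    have h := hp.mul hl
    rw [grad_mul_X, add_dotProduct, smul_dotProduct, smul_dotProduct, single_dotProduct]
    have hfun : (fun k : ℂ => MvPolynomial.eval (w + k • u) (p * MvPolynomial.X i))
        = (fun k : ℂ => MvPolynomial.eval (w + k • u) p) * fun k => w i + k * u i := by
      funext k; simp
    rw [hfun]
    exact h.congr_deriv (by simp [mul_comm])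

/-- The expansion of a polynomial along a curve with parabolic weights. -/
theorem exists_eval_parabolic_expansion (G : MvPolynomial (Fin 3) ℂ) (o q p : Fin 3 → ℂ) :
    ∃ (e : ℂ) (R : ℂ × ℂ × ℂ → ℂ), Continuous R ∧ ∀ y β α : ℂ,
      MvPolynomial.eval (o + (y * β) • q + (y ^ 2 * α) • p) G
        = MvPolynomial.eval o G + y * (β * (grad G o ⬝ᵥ q))
          + y ^ 2 * (α * (grad G o ⬝ᵥ p) + e * β ^ 2) + y ^ 3 * R (y, β, α) := by
  induction G using MvPolynomial.induction_on with
  | C a => exact ⟨0, fun _ => 0, continuous_const, fun y β α => by simp [grad, dotProduct]⟩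
  | add f g hf hg =>
    obtain ⟨e₁, R₁, hR₁, h₁⟩ := hf
    obtain ⟨e₂, R₂, hR₂, h₂⟩ := hg
    refine ⟨e₁ + e₂, fun x => R₁ x + R₂ x, hR₁.add hR₂, fun y β α => ?_⟩
    rw [grad_add, add_dotProduct, add_dotProduct, map_add, map_add, h₁, h₂]
    ring
  | mul_X f i hf =>
    obtain ⟨e, R, hR, h⟩ := hf
    -- The new coefficient and remainder come from multiplying the expansion of `f` by `o i + y * β
    -- * q i + y ^ 2 * α * p i` and collecting powers of `y`.
    refine ⟨e * o i + (grad f o ⬝ᵥ q) * q i, fun x =>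
      R x * (o i + x.1 * x.2.1 * q i + x.1 ^ 2 * x.2.2 * p i)
      + x.2.1 * q i * (x.2.2 * (grad f o ⬝ᵥ p) + e * x.2.1 ^ 2)
      + x.2.2 * p i * (x.2.1 * (grad f o ⬝ᵥ q)
        + x.1 * (x.2.2 * (grad f o ⬝ᵥ p) + e * x.2.1 ^ 2)), by fun_prop, fun y β α => ?_⟩
    rw [grad_mul_X, add_dotProduct, smul_dotProduct, smul_dotProduct, single_dotProduct,
      add_dotProduct, smul_dotProduct, smul_dotProduct, single_dotProduct, map_mul, map_mul, h,
      MvPolynomial.eval_X, MvPolynomial.eval_X]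
    simp only [Pi.add_apply, Pi.smul_apply, smul_eq_mul]
    ring

/-- The coefficients are peeled off one at a time: pass to the limit, divide by `y`, and repeat. -/
theorem parabolic_coefficients_eq_zero {X : Type*} {l : Filter X} [l.NeBot] {y β α : X → ℂ}
    {β₀ α₀ : ℂ} (hy : Filter.Tendsto y l (nhds 0)) (hβ : Filter.Tendsto β l (nhds β₀))
    (hα : Filter.Tendsto α l (nhds α₀)) (hy0 : ∀ᶠ x in l, y x ≠ 0) {c b a e : ℂ}
    {R : ℂ × ℂ × ℂ → ℂ} (hR : Continuous R)
    (h : ∀ᶠ x in l, c + y x * (β x * b) + y x ^ 2 * (α x * a + e * β x ^ 2)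
      + y x ^ 3 * R (y x, β x, α x) = 0) (hβ₀ : β₀ ≠ 0) :
    c = 0 ∧ b = 0 ∧ α₀ * a + e * β₀ ^ 2 = 0 := by
  have hRl : Filter.Tendsto (fun x => R (y x, β x, α x)) l (nhds (R (0, β₀, α₀))) :=
    (hR.tendsto _).comp (hy.prodMk_nhds (hβ.prodMk_nhds hα))
  have hQ : Filter.Tendsto (fun x => α x * a + e * β x ^ 2) l (nhds (α₀ * a + e * β₀ ^ 2)) :=
    (hα.mul_const a).add ((hβ.pow 2).const_mul e)
  have hc : c = 0 := by
    have h1 : Filter.Tendsto (fun x => c + y x * (β x * b) + y x ^ 2 * (α x * a + e * β x ^ 2)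
        + y x ^ 3 * R (y x, β x, α x)) l (nhds (c + 0 * (β₀ * b)
        + 0 ^ 2 * (α₀ * a + e * β₀ ^ 2) + 0 ^ 3 * R (0, β₀, α₀))) :=
      ((tendsto_const_nhds.add (hy.mul (hβ.mul_const b))).add ((hy.pow 2).mul hQ)).add
        ((hy.pow 3).mul hRl)
    have h2 := tendsto_nhds_unique (h1.congr' h) tendsto_const_nhds
    simpa using h2
  subst hc
  have hb : b = 0 := by
    have h1 : Filter.Tendsto (fun x => β x * b + y x * (α x * a + e * β x ^ 2)
        + y x ^ 2 * R (y x, β x, α x)) l (nhds (β₀ * b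
        + 0 * (α₀ * a + e * β₀ ^ 2) + 0 ^ 2 * R (0, β₀, α₀))) :=
      ((hβ.mul_const b).add (hy.mul hQ)).add ((hy.pow 2).mul hRl)
    have h0 : ∀ᶠ x in l, β x * b + y x * (α x * a + e * β x ^ 2)
        + y x ^ 2 * R (y x, β x, α x) = 0 := by
      filter_upwards [h, hy0] with x hx hyx
      refine (mul_eq_zero.mp ?_).resolve_left hyx
      linear_combination hx
    have h2 := tendsto_nhds_unique (h1.congr' h0) tendsto_const_nhds
    simpa [hβ₀] using h2
  subst hb
  refine ⟨rfl, rfl, ?_⟩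
  have h1 : Filter.Tendsto (fun x => (α x * a + e * β x ^ 2)
      + y x * R (y x, β x, α x)) l (nhds ((α₀ * a + e * β₀ ^ 2) + 0 * R (0, β₀, α₀))) :=
    hQ.add (hy.mul hRl)
  have h0 : ∀ᶠ x in l, (α x * a + e * β x ^ 2) + y x * R (y x, β x, α x) = 0 := by
    filter_upwards [h, hy0] with x hx hyx
    refine (mul_eq_zero.mp ?_).resolve_left (pow_ne_zero 2 hyx)
    linear_combination hx
  have h2 := tendsto_nhds_unique (h1.congr' h0) tendsto_const_nhds
  simpa using h2

/-- A simple real root persists: it is a limit of zeros with nonzero parameter. -/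
theorem mem_closure_zeros_of_simple_root {ψ : ℝ × ℝ → ℝ} (hψ : Continuous ψ) {l m : ℝ}
    (hlm : l ≠ m) (h0 : ∀ s, ψ (0, s) = (s - l) * (s - m)) :
    ((0 : ℝ), l) ∈ closure {x : ℝ × ℝ | x.1 ≠ 0 ∧ ψ x = 0} := by
  rw [Metric.mem_closure_iff]
  intro ε hε
  -- Since `δ < |l - m|`, the root `l` is the only one in `[l - δ, l + δ]`; the sign change across
  -- it at `y = 0` survives for small `y`.
  set δ := min (ε / 2) (|l - m| / 2) with hδ
  have hlm' : 0 < |l - m| := abs_pos.mpr (sub_ne_zero.mpr hlm)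
  have hδ0 : 0 < δ := lt_min (by linarith) (by linarith)
  have hδε : δ < ε := lt_of_le_of_lt (min_le_left _ _) (by linarith)
  have hδl : δ < |l - m| := lt_of_le_of_lt (min_le_right _ _) (by linarith)
  have hsq : δ ^ 2 < (l - m) ^ 2 := by
    rw [← sq_abs (l - m)]
    exact pow_lt_pow_left₀ hδl hδ0.le two_ne_zero
  have hneg : ψ (0, l - δ) * ψ (0, l + δ) < 0 := by
    rw [h0, h0]
    have : (l - δ - l) * (l - δ - m) * ((l + δ - l) * (l + δ - m))
        = -(δ ^ 2 * ((l - m) ^ 2 - δ ^ 2)) := by ring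
    rw [this, neg_lt_zero]
    exact mul_pos (pow_pos hδ0 2) (sub_pos.mpr hsq)
  have hcont : Continuous fun y : ℝ => ψ (y, l - δ) * ψ (y, l + δ) := by fun_prop
  have hev : ∀ᶠ y : ℝ in nhds 0, ψ (y, l - δ) * ψ (y, l + δ) < 0 :=
    (hcont.tendsto 0).eventually_lt_const hneg
  have hball : ∀ᶠ y : ℝ in nhds 0, dist 0 y < ε := by
    filter_upwards [Metric.ball_mem_nhds (0 : ℝ) hε] with y hy
    rwa [dist_comm]
  have hne : ∀ᶠ y : ℝ in nhdsWithin 0 {0}ᶜ, y ≠ 0 := self_mem_nhdsWithin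
  obtain ⟨y, ⟨hy1, hy2⟩, hy0⟩ :=
    (((hev.and hball).filter_mono nhdsWithin_le_nhds).and hne).exists
  have hroot : (0 : ℝ) ∈ Set.uIcc (ψ (y, l - δ)) (ψ (y, l + δ)) := by
    rw [Set.mem_uIcc]
    rcases mul_neg_iff.mp hy1 with h | h
    · exact Or.inr ⟨h.2.le, h.1.le⟩
    · exact Or.inl ⟨h.1.le, h.2.le⟩
  obtain ⟨s, hs, hs0⟩ := intermediate_value_uIcc
    (f := fun s => ψ (y, s)) (by fun_prop) hroot
  refine ⟨(y, s), ⟨hy0, hs0⟩, ?_⟩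
  rw [Prod.dist_eq, max_lt_iff]
  refine ⟨hy2, ?_⟩
  rw [Set.uIcc_of_le (by linarith)] at hs
  rw [Real.dist_eq, abs_lt]
  constructor <;> linarith [hs.1, hs.2]

/-- Along both frame directions the local equation of a tacnode is a two-by-two determinant with
quadratic entries, of which only the constant and linear coefficients count at 0. -/
theorem hasDerivAt_quadratic_det (a₀ a₁ a₂ b₀ b₁ b₂ c₀ c₁ c₂ d₀ d₁ d₂ : ℂ) :
    HasDerivAt (fun k : ℂ => (a₀ + a₁ * k + a₂ * k ^ 2) * (b₀ + b₁ * k + b₂ * k ^ 2)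
      - (c₀ + c₁ * k + c₂ * k ^ 2) * (d₀ + d₁ * k + d₂ * k ^ 2))
      (a₁ * b₀ + a₀ * b₁ - (c₁ * d₀ + c₀ * d₁)) 0 := by
  have key : ∀ x₀ x₁ x₂ : ℂ,
      HasDerivAt (fun k : ℂ => x₀ + x₁ * k + x₂ * k ^ 2) x₁ 0 := by
    intro x₀ x₁ x₂
    have h := (((hasDerivAt_id (0 : ℂ)).const_mul x₁).const_add x₀).add
      ((hasDerivAt_pow 2 (0 : ℂ)).const_mul x₂)
    simpa using! h
  have h := ((key a₀ a₁ a₂).mul (key b₀ b₁ b₂)).sub ((key c₀ c₁ c₂).mul (key d₀ d₁ d₂))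
  simpa using! h

/-! ### Two tangent branches of a dual curve -/

section Branches

variable {F : MvPolynomial (Fin 3) ℂ} {v q o p' q' o' : Fin 3 → ℂ} {t₁ t₂ g₁ g₂ : ℝ} {r h : ℂ}

/-- The gradient at a point of the curve near a tacnode, in the dual frame. -/
theorem grad_of_tacnode {d : ℕ} (hF : F.IsHomogeneous d)
    (hdual : ∀ u : Fin 3 → ℂ, u = (u ⬝ᵥ v) • p' + (u ⬝ᵥ q) • q' + (u ⬝ᵥ o) • o')
    {t₁ t₂ g₁ g₂ r r' h h' : ℂ}
    (hE : ∀ y ζ : ℂ, MvPolynomial.eval (v + y • q + ζ • o) F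
      = (ζ * (1 + ζ + y * t₁) - y ^ 2 * g₁) * (ζ * (1 + ζ + y * t₂) - y ^ 2 * g₂)
        - (y * ζ * r - y ^ 2 * h) * (y * ζ * r' - y ^ 2 * h'))
    {y s γ β : ℂ}
    (h0 : (s * (1 + y ^ 2 * s) + y * s * t₁ - g₁) * (s * (1 + y ^ 2 * s) + y * s * t₂ - g₂)
      - (y * s * r - h) * (y * s * r' - h') = 0)
    (hγ : γ = (1 + 2 * y ^ 2 * s + y * t₁) * (s * (1 + y ^ 2 * s) + y * s * t₂ - g₂)
      + (s * (1 + y ^ 2 * s) + y * s * t₁ - g₁) * (1 + 2 * y ^ 2 * s + y * t₂)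
      - y * (r * (y * s * r' - h') + (y * s * r - h) * r'))
    (hβ : β = (y * s * t₁ - 2 * g₁) * (s * (1 + y ^ 2 * s) + y * s * t₂ - g₂)
      + (s * (1 + y ^ 2 * s) + y * s * t₁ - g₁) * (y * s * t₂ - 2 * g₂)
      - ((y * s * r - 2 * h) * (y * s * r' - h') + (y * s * r - h) * (y * s * r' - 2 * h'))) :
    MvPolynomial.eval (v + y • q + (y ^ 2 * s) • o) F = 0 ∧
    grad F (v + y • q + (y ^ 2 * s) • o)
      = (-(y ^ 4 * (β + s * γ))) • p' + (y ^ 3 * β) • q' + (y ^ 2 * γ) • o' := by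
  set w := v + y • q + (y ^ 2 * s) • o with hw
  -- With `ζ = y ^ 2 * s` each of the four factors is divisible by `y ^ 2`, and `h0` is the equation
  -- divided by `y ^ 4`.
  have hw0 : MvPolynomial.eval w F = 0 := by
    rw [hw, hE]
    linear_combination y ^ 4 * h0
  have hq : grad F w ⬝ᵥ q = y ^ 3 * β := by
    refine (hasDerivAt_eval_line F w q).unique ?_
    have h1 := hasDerivAt_quadratic_det
      (y ^ 2 * s * (1 + y ^ 2 * s + y * t₁) - y ^ 2 * g₁) (y ^ 2 * s * t₁ - 2 * y * g₁) (-g₁)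
      (y ^ 2 * s * (1 + y ^ 2 * s + y * t₂) - y ^ 2 * g₂) (y ^ 2 * s * t₂ - 2 * y * g₂) (-g₂)
      (y * (y ^ 2 * s) * r - y ^ 2 * h) (y ^ 2 * s * r - 2 * y * h) (-h)
      (y * (y ^ 2 * s) * r' - y ^ 2 * h') (y ^ 2 * s * r' - 2 * y * h') (-h')
    have hfun : (fun k : ℂ => MvPolynomial.eval (w + k • q) F) = fun k : ℂ =>
        MvPolynomial.eval (v + (y + k) • q + (y ^ 2 * s) • o) F := by
      funext k
      congr 2
      rw [hw]
      module
    rw [hfun]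
    refine (h1.congr_deriv (by rw [hβ]; ring)).congr_of_eventuallyEq
      (Filter.Eventually.of_forall fun k => ?_)
    simp only [hE]
    ring
  have ho : grad F w ⬝ᵥ o = y ^ 2 * γ := by
    refine (hasDerivAt_eval_line F w o).unique ?_
    have h1 := hasDerivAt_quadratic_det
      (y ^ 2 * s * (1 + y ^ 2 * s + y * t₁) - y ^ 2 * g₁) (1 + 2 * (y ^ 2 * s) + y * t₁) 1
      (y ^ 2 * s * (1 + y ^ 2 * s + y * t₂) - y ^ 2 * g₂) (1 + 2 * (y ^ 2 * s) + y * t₂) 1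
      (y * (y ^ 2 * s) * r - y ^ 2 * h) (y * r) 0
      (y * (y ^ 2 * s) * r' - y ^ 2 * h') (y * r') 0
    have hfun : (fun k : ℂ => MvPolynomial.eval (w + k • o) F) = fun k : ℂ =>
        MvPolynomial.eval (v + y • q + (y ^ 2 * s + k) • o) F := by
      funext k
      congr 2
      rw [hw]
      module
    rw [hfun]
    refine (h1.congr_deriv (by rw [hγ]; ring)).congr_of_eventuallyEq
      (Filter.Eventually.of_forall fun k => ?_)
    simp only [hE]
    ring
  -- The third component follows from Euler's relation, since `F` vanishes at `w`.
  have hv : grad F w ⬝ᵥ v = -(y ^ 4 * (β + s * γ)) := by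
    have he := grad_dotProduct_self_of_isHomogeneous hF w
    rw [hw0, mul_zero] at he
    have hsplit : grad F w ⬝ᵥ w = grad F w ⬝ᵥ v + y * (grad F w ⬝ᵥ q)
        + y ^ 2 * s * (grad F w ⬝ᵥ o) := by
      conv_lhs => rw [hw]
      rw [dotProduct_add, dotProduct_add, dotProduct_smul, dotProduct_smul, ← hw]
      rfl
    rw [hsplit, hq, ho] at he
    linear_combination he
  refine ⟨hw0, ?_⟩
  conv_lhs => rw [hdual (grad F w)]
  rw [hv, hq, ho]

variable (hdual : ∀ u : Fin 3 → ℂ, u = (u ⬝ᵥ v) • p' + (u ⬝ᵥ q) • q' + (u ⬝ᵥ o) • o')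
  (ho' : o' ⬝ᵥ o = 1) (hq' : q' ⬝ᵥ o = 0) (hp' : p' ⬝ᵥ o = 0)
  (hE : ∀ y ζ : ℂ, MvPolynomial.eval (v + y • q + ζ • o) F
      = (ζ * (1 + ζ + y * t₁) - y ^ 2 * g₁) * (ζ * (1 + ζ + y * t₂) - y ^ 2 * g₂)
        - (y * ζ * r - y ^ 2 * h) * (y * ζ * conj r - y ^ 2 * conj h))

include hdual ho' hq' hp' hE in
-- Each simple root `l` of the limiting quadratic carries a real branch `ζ = y ^ 2 * s` with `s`
-- tending to `l`. Its normalised gradient is `o' + (y * β) • q' + (y ^ 2 * α) • p'` with `β → -2 *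
-- l` and `α → l`, a parabola to second order. Inserting it in the expansion of `G` gives `c = b =
-- 0` and `l * (a + 4 * l * e) = 0`.
theorem coefficients_of_branch {d : ℕ} (hF : F.IsHomogeneous d) {l m : ℝ} (hlm : l ≠ m)
    (hl : l ≠ 0) (hroots : ∀ s : ℝ, (s - g₁) * (s - g₂) - Complex.normSq h = (s - l) * (s - m))
    {G : MvPolynomial (Fin 3) ℂ} {k : ℕ} (hG : G.IsHomogeneous k)
    (hGF : ∀ w, MvPolynomial.eval w F = 0 → grad F w ≠ 0 →
      MvPolynomial.eval (grad F w) G = 0)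
    {c b a e : ℂ} {R : ℂ × ℂ × ℂ → ℂ} (hR : Continuous R)
    (hexp : ∀ y β α : ℂ, MvPolynomial.eval (o' + (y * β) • q' + (y ^ 2 * α) • p') G
      = c + y * (β * b) + y ^ 2 * (α * a + e * β ^ 2) + y ^ 3 * R (y, β, α)) :
    c = 0 ∧ b = 0 ∧ a + 4 * l * e = 0 := by
  -- This is the equation of the curve at `(y, y ^ 2 * s)` divided by `y ^ 4`. It is real because
  -- the two off-diagonal factors are conjugate for real `y` and `s`.
  set ψ : ℝ × ℝ → ℝ := fun x =>
    (x.2 * (1 + x.1 ^ 2 * x.2) + x.1 * x.2 * t₁ - g₁)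
      * (x.2 * (1 + x.1 ^ 2 * x.2) + x.1 * x.2 * t₂ - g₂)
      - Complex.normSq (x.1 * x.2 * r - h) with hψ
  have hψc : Continuous ψ := by
    have : Continuous fun x : ℝ × ℝ => Complex.normSq ((x.1 : ℂ) * x.2 * r - h) :=
      Complex.continuous_normSq.comp (by fun_prop)
    fun_prop
  have hcl := mem_closure_zeros_of_simple_root hψc hlm (fun s => by
    rw [← hroots s, hψ]
    simp [Complex.normSq_neg])
  set S : Set (ℝ × ℝ) := {x | x.1 ≠ 0 ∧ ψ x = 0} with hS
  have hne : (nhdsWithin ((0 : ℝ), l) S).NeBot := mem_closure_iff_nhdsWithin_neBot.mp hcl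
  set L := nhdsWithin ((0 : ℝ), l) S with hL
  set γ : ℝ × ℝ → ℂ := fun x =>
    (1 + 2 * (x.1 : ℂ) ^ 2 * x.2 + x.1 * t₁) * (x.2 * (1 + x.1 ^ 2 * x.2) + x.1 * x.2 * t₂ - g₂)
      + (x.2 * (1 + x.1 ^ 2 * x.2) + x.1 * x.2 * t₁ - g₁) * (1 + 2 * x.1 ^ 2 * x.2 + x.1 * t₂)
      - x.1 * (r * (x.1 * x.2 * conj r - conj h) + (x.1 * x.2 * r - h) * conj r) with hγ
  set β : ℝ × ℝ → ℂ := fun x =>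
    ((x.1 : ℂ) * x.2 * t₁ - 2 * g₁) * (x.2 * (1 + x.1 ^ 2 * x.2) + x.1 * x.2 * t₂ - g₂)
      + (x.2 * (1 + x.1 ^ 2 * x.2) + x.1 * x.2 * t₁ - g₁) * (x.1 * x.2 * t₂ - 2 * g₂)
      - ((x.1 * x.2 * r - 2 * h) * (x.1 * x.2 * conj r - conj h)
        + (x.1 * x.2 * r - h) * (x.1 * x.2 * conj r - 2 * conj h)) with hβ
  have hγc : Continuous γ := by fun_prop
  have hβc : Continuous β := by fun_prop
  have hsum : g₁ + g₂ = l + m := by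
    have h0 := hroots 0
    have h1 := hroots 1
    linarith
  have hprod : h * conj h = g₁ * g₂ - l * m := by
    rw [Complex.mul_conj]
    have h0 := hroots 0
    have : Complex.normSq h = g₁ * g₂ - l * m := by linarith
    rw [this]; push_cast; ring
  have hsum' : (g₁ : ℂ) = l + m - g₂ := by
    rw [eq_sub_iff_add_eq]; exact_mod_cast hsum
  have hlm' : (l : ℂ) - m ≠ 0 := sub_ne_zero.mpr (by exact_mod_cast hlm)
  have hl' : (l : ℂ) ≠ 0 := by exact_mod_cast hl
  have hγ0 : γ (0, l) = l - m := by
    simp only [hγ]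
    push_cast
    rw [hsum']
    ring
  have hβ0 : β (0, l) = -2 * l * (l - m) := by
    simp only [hβ]
    push_cast
    rw [hsum'] at hprod ⊢
    linear_combination (-4 : ℂ) * hprod
  have hLle : L ≤ nhds ((0 : ℝ), l) := nhdsWithin_le_nhds
  have hγl : Filter.Tendsto γ L (nhds (l - m)) := by
    rw [← hγ0]; exact (hγc.tendsto _).mono_left hLle
  have hβl : Filter.Tendsto β L (nhds (-2 * l * (l - m))) := by
    rw [← hβ0]; exact (hβc.tendsto _).mono_left hLle
  have hyl : Filter.Tendsto (fun x : ℝ × ℝ => (x.1 : ℂ)) L (nhds 0) := by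
    have : Continuous fun x : ℝ × ℝ => (x.1 : ℂ) := by fun_prop
    simpa using (this.tendsto ((0 : ℝ), l)).mono_left hLle
  have hsl : Filter.Tendsto (fun x : ℝ × ℝ => (x.2 : ℂ)) L (nhds l) := by
    have : Continuous fun x : ℝ × ℝ => (x.2 : ℂ) := by fun_prop
    simpa using (this.tendsto ((0 : ℝ), l)).mono_left hLle
  have hβγ : Filter.Tendsto (fun x => β x / γ x) L (nhds (-2 * l)) := by
    have := hβl.div hγl hlm'
    rwa [mul_div_assoc, div_self hlm', mul_one] at this
  have hαγ : Filter.Tendsto (fun x : ℝ × ℝ => -(β x / γ x + x.2)) L (nhds l) := by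
    have := (hβγ.add hsl).neg
    convert this using 2
    ring
  have hmem : ∀ᶠ x in L, x ∈ S := self_mem_nhdsWithin
  have hγne : ∀ᶠ x in L, γ x ≠ 0 := hγl.eventually_ne hlm'
  have hy0 : ∀ᶠ x : ℝ × ℝ in L, (x.1 : ℂ) ≠ 0 := by
    filter_upwards [hmem] with x hx
    exact_mod_cast hx.1
  have hzero : ∀ᶠ x : ℝ × ℝ in L, c + (x.1 : ℂ) * (β x / γ x * b) + (x.1 : ℂ) ^ 2
      * (-(β x / γ x + x.2) * a + e * (β x / γ x) ^ 2)
      + (x.1 : ℂ) ^ 3 * R (x.1, β x / γ x, -(β x / γ x + x.2)) = 0 := by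
    filter_upwards [hmem, hγne, hy0] with x hx hγx hyx
    have hψx : ((x.2 : ℂ) * (1 + x.1 ^ 2 * x.2) + x.1 * x.2 * t₁ - g₁)
        * (x.2 * (1 + x.1 ^ 2 * x.2) + x.1 * x.2 * t₂ - g₂)
        - (x.1 * x.2 * r - h) * (x.1 * x.2 * conj r - conj h) = 0 := by
      have h1 := congrArg (fun s : ℝ => (s : ℂ)) hx.2
      simp only [hψ, Complex.ofReal_sub, ← Complex.mul_conj] at h1
      push_cast at h1
      rw [map_sub, map_mul, map_mul, Complex.conj_ofReal, Complex.conj_ofReal] at h1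
      exact h1
    obtain ⟨hw0, hgrad⟩ := grad_of_tacnode hF hdual hE hψx
      (γ := γ x) (β := β x) rfl rfl
    have hfac : grad F (v + (x.1 : ℂ) • q + ((x.1 : ℂ) ^ 2 * x.2) • o)
        = ((x.1 : ℂ) ^ 2 * γ x) • (o' + ((x.1 : ℂ) * (β x / γ x)) • q'
          + ((x.1 : ℂ) ^ 2 * -(β x / γ x + x.2)) • p') := by
      rw [hgrad]
      simp only [smul_add, smul_smul]
      have e1 : -((x.1 : ℂ) ^ 4 * (β x + x.2 * γ x))
          = x.1 ^ 2 * γ x * (x.1 ^ 2 * -(β x / γ x + x.2)) := by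
        field_simp
      have e2 : (x.1 : ℂ) ^ 3 * β x = x.1 ^ 2 * γ x * (x.1 * (β x / γ x)) := by
        field_simp
      rw [e1, e2]
      abel
    have hpre : (x.1 : ℂ) ^ 2 * γ x ≠ 0 := mul_ne_zero (pow_ne_zero 2 hyx) hγx
    have hg0 : grad F (v + (x.1 : ℂ) • q + ((x.1 : ℂ) ^ 2 * x.2) • o) ≠ 0 := by
      intro h0
      have h1 := congrArg (fun u => u ⬝ᵥ o) hgrad
      simp only [h0, zero_dotProduct, add_dotProduct, smul_dotProduct, ho', hq', hp',
        smul_eq_mul, mul_zero, mul_one, zero_add] at h1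
      exact hpre h1.symm
    have h1 := hGF _ hw0 hg0
    rw [hfac, eval_smul_of_isHomogeneous hG] at h1
    have h2 := (mul_eq_zero.mp h1).resolve_left (pow_ne_zero _ hpre)
    rwa [hexp] at h2
  obtain ⟨hc, hb, ha⟩ := parabolic_coefficients_eq_zero hyl hβγ hαγ hy0 hR hzero
    (mul_ne_zero (by norm_num) hl')
  refine ⟨hc, hb, ?_⟩
  refine (mul_eq_zero.mp ?_).resolve_left hl'
  linear_combination ha

include hdual ho' hq' hp' hE in
/-- A form vanishing on the tangent lines near a real tacnode is singular at its tangent line. -/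
theorem grad_eq_zero_of_tacnode {d : ℕ} (hF : F.IsHomogeneous d)
    (hdisc : g₁ ≠ g₂ ∨ h ≠ 0) (hdet : g₁ * g₂ - Complex.normSq h ≠ 0)
    {G : MvPolynomial (Fin 3) ℂ} {k : ℕ} (hG : G.IsHomogeneous k)
    (hGF : ∀ w, MvPolynomial.eval w F = 0 → grad F w ≠ 0 →
      MvPolynomial.eval (grad F w) G = 0) :
    MvPolynomial.eval o' G = 0 ∧ grad G o' = 0 := by
  -- The discriminant of the Hermitian matrix with diagonal `g₁`, `g₂` and off-diagonal entry `h`.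
  -- Its eigenvalues `l` and `m` are distinct by `hdisc` and nonzero by `hdet`.
  set D : ℝ := (g₁ - g₂) ^ 2 + 4 * Complex.normSq h with hD
  have hD0 : 0 < D := by
    rcases hdisc with h1 | h1
    · have := Complex.normSq_nonneg h
      have := sq_pos_of_ne_zero (sub_ne_zero.mpr h1)
      rw [hD]; linarith
    · have := Complex.normSq_pos.mpr h1
      have := sq_nonneg (g₁ - g₂)
      rw [hD]; linarith
  have hsq : Real.sqrt D ^ 2 = D := Real.sq_sqrt hD0.le
  have hs0 : 0 < Real.sqrt D := Real.sqrt_pos.mpr hD0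
  set l := (g₁ + g₂ + Real.sqrt D) / 2 with hl
  set m := (g₁ + g₂ - Real.sqrt D) / 2 with hm
  have hlm : l ≠ m := by
    intro h1
    rw [hl, hm] at h1
    linarith
  have hprod : l * m = g₁ * g₂ - Complex.normSq h := by
    have : l * m = ((g₁ + g₂) ^ 2 - Real.sqrt D ^ 2) / 4 := by rw [hl, hm]; ring
    rw [this, hsq, hD]; ring
  have hroots : ∀ s : ℝ, (s - g₁) * (s - g₂) - Complex.normSq h = (s - l) * (s - m) := by
    intro s
    have : l + m = g₁ + g₂ := by rw [hl, hm]; ring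
    linear_combination s * this - hprod
  have hlm0 : l * m ≠ 0 := by rwa [hprod]
  obtain ⟨e, R, hR, hexp⟩ := exists_eval_parabolic_expansion G o' q' p'
  obtain ⟨hc, hb, ha⟩ := coefficients_of_branch hdual ho' hq' hp' hE hF hlm
    (left_ne_zero_of_mul hlm0) hroots hG hGF hR hexp
  obtain ⟨-, -, ha'⟩ := coefficients_of_branch hdual ho' hq' hp' hE hF hlm.symm
    (right_ne_zero_of_mul hlm0) (fun s => (hroots s).trans (mul_comm _ _)) hG hGF hR hexp
  have hlm' : (l : ℂ) - m ≠ 0 := sub_ne_zero.mpr (by exact_mod_cast hlm)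
  -- The relation `a + 4 * l * e = 0` holds for both curvature parameters; subtraction isolates `e`.
  have he : e = 0 := by
    refine (mul_eq_zero.mp ?_).resolve_left (mul_ne_zero (by norm_num : (4 : ℂ) ≠ 0) hlm')
    linear_combination ha - ha'
  have hp0 : grad G o' ⬝ᵥ p' = 0 := by
    rw [he, mul_zero, add_zero] at ha
    exact ha
  have ho0 : grad G o' ⬝ᵥ o' = 0 := by
    rw [grad_dotProduct_self_of_isHomogeneous hG, hc, mul_zero]
  refine ⟨hc, ?_⟩
  funext i
  -- The gradient annihilates `p'`, `q'` and `o'`, which span the space by `hdual`.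
  have h1 : grad G o' ⬝ᵥ Pi.single i 1 = 0 := by
    rw [hdual (Pi.single i 1), dotProduct_add, dotProduct_add, dotProduct_smul, dotProduct_smul,
      dotProduct_smul, hp0, hb, ho0]
    simp
  simpa using h1

end Branches

/-! ### Singular points of dual curves -/

theorem isHomogeneous_basePolynomial {n : ℕ} (A : Matrix (Fin n) (Fin n) ℂ) :
    (basePolynomial A).IsHomogeneous n := by
  rw [basePolynomial, Matrix.det_apply']
  refine MvPolynomial.IsHomogeneous.sum _ _ _ fun τ _ => ?_
  have h1 : (((Equiv.Perm.sign τ : ℤ) : MvPolynomial (Fin 3) ℂ)).IsHomogeneous 0 := by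
    have : ((Equiv.Perm.sign τ : ℤ) : MvPolynomial (Fin 3) ℂ)
        = MvPolynomial.C ((Equiv.Perm.sign τ : ℤ) : ℂ) := by simp
    rw [this]
    exact MvPolynomial.isHomogeneous_C _ _
  have h2 := MvPolynomial.IsHomogeneous.prod (Finset.univ : Finset (Fin n))
    (fun i => ((MvPolynomial.X 0 : MvPolynomial (Fin 3) ℂ) • (rePart A).map MvPolynomial.C
      + (MvPolynomial.X 1 : MvPolynomial (Fin 3) ℂ) • (imPart A).map MvPolynomial.C
      + (MvPolynomial.X 2 : MvPolynomial (Fin 3) ℂ) • (1 : Matrix (Fin n) (Fin n) _) :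
        Matrix (Fin n) (Fin n) (MvPolynomial (Fin 3) ℂ)) (τ i) i)
    (fun _ => 1) (fun i _ => by
      refine MvPolynomial.IsHomogeneous.add (MvPolynomial.IsHomogeneous.add ?_ ?_) ?_
      · exact (MvPolynomial.isHomogeneous_X _ 0).mul (MvPolynomial.isHomogeneous_C _ _)
      · exact (MvPolynomial.isHomogeneous_X _ 1).mul (MvPolynomial.isHomogeneous_C _ _)
      · refine (MvPolynomial.isHomogeneous_X _ 2).mul (n := 0) ?_
        rw [Matrix.one_apply]
        split_ifs
        · exact MvPolynomial.isHomogeneous_one _ _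
        · exact MvPolynomial.isHomogeneous_zero _ _ _)
  have h3 := h1.mul h2
  simpa using h3

theorem exists_rep_mk_eq_smul {u : Fin 3 → ℂ} (hu : u ≠ 0) :
    ∃ c : ℂ, c ≠ 0 ∧ (Projectivization.mk ℂ u hu).rep = c • u := by
  obtain ⟨a, ha⟩ := Projectivization.exists_smul_eq_mk_rep ℂ u hu
  exact ⟨a, a.ne_zero, ha.symm⟩

theorem eval_rep_mk_eq_zero_iff {G : MvPolynomial (Fin 3) ℂ} {k : ℕ} (hG : G.IsHomogeneous k)
    {u : Fin 3 → ℂ} (hu : u ≠ 0) :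
    MvPolynomial.eval (Projectivization.mk ℂ u hu).rep G = 0 ↔ MvPolynomial.eval u G = 0 := by
  obtain ⟨c, hc, h⟩ := exists_rep_mk_eq_smul hu
  rw [h, eval_smul_of_isHomogeneous hG, mul_eq_zero, or_iff_right (pow_ne_zero _ hc)]

/-- Forms vanishing on the tangent lines of a plane curve `F = 0` vanish at the gradients of `F`. -/
theorem eval_grad_eq_zero_of_vanishing {F G : MvPolynomial (Fin 3) ℂ} {d k : ℕ} (hd : 2 ≤ d)
    (hF : F.IsHomogeneous d) (hG : G.IsHomogeneous k)
    (hGv : ∀ L, IsTangentLine {P : CP2 | MvPolynomial.eval P.rep F = 0} L →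
      MvPolynomial.eval L.rep G = 0)
    {w : Fin 3 → ℂ} (hw : MvPolynomial.eval w F = 0) (hg : grad F w ≠ 0) :
    MvPolynomial.eval (grad F w) G = 0 := by
  have hw0 : w ≠ 0 := by
    rintro rfl
    apply hg
    have := grad_smul_of_isHomogeneous hF 0 0
    rwa [zero_pow (by omega), zero_smul, zero_smul] at this
  obtain ⟨c, hc, hrep⟩ := exists_rep_mk_eq_smul hw0
  have hgr : grad F (Projectivization.mk ℂ w hw0).rep = c ^ (d - 1) • grad F w := by
    rw [hrep, grad_smul_of_isHomogeneous hF]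
  have hgr0 : grad F (Projectivization.mk ℂ w hw0).rep ≠ 0 := by
    rw [hgr]; exact smul_ne_zero (pow_ne_zero _ hc) hg
  -- The form `F` lies in the ideal of its zero set, so a nonzero gradient of `F` is a tangent line
  -- even when `F` is not reduced.
  have h1 := hGv _ ⟨Projectivization.mk ℂ w hw0, (eval_rep_mk_eq_zero_iff hF hw0).mpr hw, F,
    ⟨⟨d, hF⟩, fun P hP => hP⟩, hgr0, rfl⟩
  rw [eval_rep_mk_eq_zero_iff hG, hgr, eval_smul_of_isHomogeneous hG] at h1
  exact (mul_eq_zero.mp h1).resolve_left (pow_ne_zero _ (pow_ne_zero _ hc))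

theorem isSingularPoint_dualCurve {F : MvPolynomial (Fin 3) ℂ} {d : ℕ} (hd : 2 ≤ d)
    (hF : F.IsHomogeneous d) {u : Fin 3 → ℂ} (hu : u ≠ 0)
    (h : ∀ (G : MvPolynomial (Fin 3) ℂ) (k : ℕ), G.IsHomogeneous k →
      (∀ w, MvPolynomial.eval w F = 0 → grad F w ≠ 0 → MvPolynomial.eval (grad F w) G = 0) →
      MvPolynomial.eval u G = 0 ∧ grad G u = 0) :
    IsSingularPoint (dualCurve {P : CP2 | MvPolynomial.eval P.rep F = 0})
      (Projectivization.mk ℂ u hu) := by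
  refine ⟨?_, ?_⟩
  · rintro G ⟨⟨k, hG⟩, hGv⟩
    rw [eval_rep_mk_eq_zero_iff hG]
    exact (h G k hG fun w => eval_grad_eq_zero_of_vanishing hd hF hG hGv).1
  · rintro G ⟨⟨k, hG⟩, hGv⟩
    -- A form vanishing on the Zariski closure vanishes on the tangent lines themselves.
    have hGv' : ∀ L, IsTangentLine {P : CP2 | MvPolynomial.eval P.rep F = 0} L →
        MvPolynomial.eval L.rep G = 0 := fun L hL => hGv L fun H hH => hH.2 L hL
    obtain ⟨c, -, hrep⟩ := exists_rep_mk_eq_smul hu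
    rw [hrep, grad_smul_of_isHomogeneous hG,
      (h G k hG fun w => eval_grad_eq_zero_of_vanishing hd hF hG hGv').2, smul_zero]

theorem complexify_ne_zero {v : Fin 3 → ℝ} (hv : v 0 ≠ 0 ∨ v 1 ≠ 0) : complexify v ≠ 0 := by
  intro h
  rcases hv with h1 | h1
  · exact h1 (by simpa [complexify] using congrFun h 0)
  · exact h1 (by simpa [complexify] using congrFun h 1)

theorem mem_dualLine_mk_iff {v : Fin 3 → ℝ} (hv : complexify v ≠ 0) (z : ℂ) :
    z ∈ dualLine (Projectivization.mk ℂ (complexify v) hv)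
      ↔ v 0 * z.re + v 1 * z.im + v 2 = 0 := by
  rw [dualLine, Set.mem_ofPred_eq, affinePoint, Projectivization.orthogonal_mk, dotProduct, Fin.sum_univ_three]
  simp only [Matrix.cons_val, mul_one]
  norm_cast

/-! ### Polarization and the determinant of the block pencil -/

section Polarization

variable {E : Type*} [NormedAddCommGroup E] [InnerProductSpace ℂ E]

/-- Complex polarization: the values at `x + y` and `x + I • y` determine the mixed term. -/
theorem inner_map_eq_zero_of_forall_self (T : E →ₗ[ℂ] E) (K : Submodule ℂ E)
    (h : ∀ x ∈ K, ‖x‖ = 1 → inner ℂ x (T x) = 0) {x y : E} (hx : x ∈ K) (hy : y ∈ K) :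
    inner ℂ x (T y) = 0 := by
  have h' : ∀ x ∈ K, inner ℂ x (T x) = 0 := by
    intro x hx
    by_cases h0 : x = 0
    · simp [h0]
    have hn : ‖x‖ ≠ 0 := norm_ne_zero_iff.mpr h0
    have h1 := h (((‖x‖⁻¹ : ℝ) : ℂ) • x) (K.smul_mem _ hx) (by
      rw [norm_smul, Complex.norm_real, norm_inv, norm_norm, inv_mul_cancel₀ hn])
    rw [inner_map_smul_self] at h1
    refine (mul_eq_zero.mp h1).resolve_left ?_
    rw [Complex.norm_real, norm_inv, norm_norm]
    exact_mod_cast pow_ne_zero 2 (inv_ne_zero hn)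
  have h1 := h' _ (K.add_mem hx hy)
  have h2 := h' _ (K.add_mem hx (K.smul_mem Complex.I hy))
  simp only [map_add, map_smul, inner_add_left, inner_add_right, inner_smul_left,
    inner_smul_right, h' x hx, h' y hy, Complex.conj_I] at h1 h2
  linear_combination (1 / 2 : ℂ) * h1 - (Complex.I / 2) * h2
    + (1 / 2 : ℂ) * (inner ℂ x (T y) - inner ℂ y (T x)) * Complex.I_sq

end Polarization

/-- A Schur complement: with upper left block `ζ` times the identity, the determinant is that of the
two-by-two matrix `ζ * D - y ^ 2 * B * C`, where `D` is the lower right block and `y * B`, `y * C`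
are the off-diagonal ones. -/
theorem det_tacnode_pencil (y ζ b₀₂ b₀₃ b₁₂ b₁₃ b₂₀ b₂₁ b₃₀ b₃₁ t₂₂ t₂₃ t₃₂ t₃₃ : ℂ) :
    (!![ζ, 0, y * b₀₂, y * b₀₃; 0, ζ, y * b₁₂, y * b₁₃;
      y * b₂₀, y * b₂₁, 1 + ζ + y * t₂₂, y * t₂₃;
      y * b₃₀, y * b₃₁, y * t₃₂, 1 + ζ + y * t₃₃] : Matrix (Fin 4) (Fin 4) ℂ).det
    = (ζ * (1 + ζ + y * t₂₂) - y ^ 2 * (b₂₀ * b₀₂ + b₂₁ * b₁₂))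
        * (ζ * (1 + ζ + y * t₃₃) - y ^ 2 * (b₃₀ * b₀₃ + b₃₁ * b₁₃))
      - (y * ζ * t₂₃ - y ^ 2 * (b₂₀ * b₀₃ + b₂₁ * b₁₃))
        * (y * ζ * t₃₂ - y ^ 2 * (b₃₀ * b₀₂ + b₃₁ * b₁₂)) := by
  simp [Matrix.det_succ_row_zero, Fin.sum_univ_succ, Fin.succAbove]
  ring

/-! ### Pencils that are orthogonal projections -/

section Projection

variable {n : ℕ} {A : Matrix (Fin n) (Fin n) ℂ} {v : Fin 3 → ℝ}

theorem pencilOp_isPositive_of_forall_basis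
    (b : OrthonormalBasis (Fin n) ℂ (EuclideanSpace ℂ (Fin n)))
    (h : ∀ j, pencilOp A v (b j) = 0 ∨ pencilOp A v (b j) = b j) :
    (pencilOp A v).IsPositive := by
  have hid : IsIdempotentElem (pencilOp A v) := by
    refine b.toBasis.ext fun j => ?_
    rw [OrthonormalBasis.coe_toBasis, Module.End.mul_apply]
    rcases h j with hj | hj
    · rw [hj, map_zero]
    · rw [hj, hj]
  exact (LinearMap.IsIdempotentElem.isPositive_iff_isSymmetric hid).mpr (pencilOp_isSymmetric A v)

theorem isSupportLine_dualLine_mk (hv : v 0 ≠ 0 ∨ v 1 ≠ 0) (hpos : (pencilOp A v).IsPositive)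
    {x : EuclideanSpace ℂ (Fin n)} (hx : ‖x‖ = 1) (hx0 : pencilOp A v x = 0) :
    IsSupportLine (numericalRange A)
      (dualLine (Projectivization.mk ℂ (complexify v) (complexify_ne_zero hv))) := by
  refine ⟨v 0, v 1, v 2, hv, ?_, ⟨_, ?_, ⟨x, hx, rfl⟩⟩, (pencilOp_isPositive_iff A v).mp hpos⟩
  · ext z
    exact mem_dualLine_mk_iff _ z
  · rw [mem_dualLine_mk_iff]
    have := inner_pencilOp_self A v hx
    rw [hx0, inner_zero_right] at this
    exact_mod_cast this.symm

theorem card_le_curveOrder_mk (hv : complexify v ≠ 0)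
    (b : OrthonormalBasis (Fin n) ℂ (EuclideanSpace ℂ (Fin n))) (S : Finset (Fin n))
    (h : ∀ j ∈ S, pencilOp A v (b j) = 0) :
    (S.card : ℕ∞) ≤ curveOrder (basePolynomial A) (Projectivization.mk ℂ (complexify v) hv) := by
  obtain ⟨c, -, hrep⟩ := exists_rep_mk_eq_smul hv
  refine card_le_curveOrder b S fun j hj => ?_
  rw [hrep, pencil_smul, map_smul, LinearMap.smul_apply]
  have := h j hj
  rw [pencilOp] at this
  rw [this, smul_zero]

theorem eq_zero_of_common_kernel (hn : 3 ≤ n) (hirr : IsUnitarilyIrreducible A) {q : Fin 3 → ℝ}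
    (hvq : v 0 * q 1 - v 1 * q 0 ≠ 0) {x : EuclideanSpace ℂ (Fin n)}
    (hx : pencilOp A v x = 0) (hqx : pencilOp A q x = 0) : x = 0 := by
  by_contra h0
  exact hirr (isUnitarilyReducible_of_span_pair hn hvq h0 (y := x) (by simp [hx]) (by simp [hx])
    (by simp [hqx]) (by simp [hqx]))

theorem inner_pencilOp_conj (q : Fin 3 → ℝ) (x y : EuclideanSpace ℂ (Fin n)) :
    conj (inner ℂ x (pencilOp A q y)) = inner ℂ y (pencilOp A q x) := by
  rw [inner_conj_symm, pencilOp_isSymmetric]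

/-- The real point conjugate to `v` whose pencil has zero numerical value where that of `v` and
the matrix have the values `0` and `z`. -/
def conjugatePoint (v : Fin 3 → ℝ) (z : ℂ) : Fin 3 → ℝ :=
  ![-v 1, v 0, v 1 * z.re - v 0 * z.im]

theorem conjugatePoint_ne (hv : v 0 ≠ 0 ∨ v 1 ≠ 0) (z : ℂ) :
    v 0 * conjugatePoint v z 1 - v 1 * conjugatePoint v z 0 ≠ 0 := by
  have : v 0 * conjugatePoint v z 1 - v 1 * conjugatePoint v z 0 = v 0 ^ 2 + v 1 ^ 2 := by
    simp [conjugatePoint]; ring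
  rw [this]
  rcases hv with h | h <;> positivity

/-- The line of the conjugate point passes through `z`, so its quadratic form vanishes on the unit
vectors of the kernel, and polarization does the rest. -/
theorem inner_conjugatePoint_eq_zero {z : ℂ}
    (hz : ∀ x, ‖x‖ = 1 → pencilOp A v x = 0 → inner ℂ x (Matrix.toEuclideanLin A x) = z)
    {x y : EuclideanSpace ℂ (Fin n)} (hx : pencilOp A v x = 0) (hy : pencilOp A v y = 0) :
    inner ℂ x (pencilOp A (conjugatePoint v z) y) = 0 := by
  refine inner_map_eq_zero_of_forall_self _ (LinearMap.ker (pencilOp A v)) (fun u hu hu1 => ?_)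
    (LinearMap.mem_ker.mpr hx) (LinearMap.mem_ker.mpr hy)
  rw [inner_pencilOp_self A _ hu1, hz u hu1 (LinearMap.mem_ker.mp hu)]
  simp [conjugatePoint]

end Projection

/-! ### Consequences of irreducibility for the blocks of a conjugate pencil -/

section FourByFour

variable {A : Matrix (Fin 4) (Fin 4) ℂ} {v : Fin 3 → ℝ}

/-- The compression of the second pencil to the kernel is zero. A null vector of the off-diagonal
block would therefore be a common kernel vector of both pencils, spanning a reducing line. -/
theorem offDiagonal_det_ne_zero (b : OrthonormalBasis (Fin 4) ℂ (EuclideanSpace ℂ (Fin 4)))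
    (hirr : IsUnitarilyIrreducible A) {q : Fin 3 → ℝ}
    (hvq : v 0 * q 1 - v 1 * q 0 ≠ 0)
    (h0 : pencilOp A v (b 0) = 0) (h1 : pencilOp A v (b 1) = 0)
    (hq : ∀ x y, pencilOp A v x = 0 → pencilOp A v y = 0 → inner ℂ x (pencilOp A q y) = 0) :
    inner ℂ (b 2) (pencilOp A q (b 0)) * inner ℂ (b 3) (pencilOp A q (b 1))
      - inner ℂ (b 2) (pencilOp A q (b 1)) * inner ℂ (b 3) (pencilOp A q (b 0)) ≠ 0 := by
  intro hdet
  set B : Matrix (Fin 2) (Fin 2) ℂ :=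
    !![inner ℂ (b 2) (pencilOp A q (b 0)), inner ℂ (b 2) (pencilOp A q (b 1));
      inner ℂ (b 3) (pencilOp A q (b 0)), inner ℂ (b 3) (pencilOp A q (b 1))] with hB
  obtain ⟨c, hc, hBc⟩ := Matrix.exists_mulVec_eq_zero_iff.mpr
    (show B.det = 0 by rw [hB, Matrix.det_fin_two_of]; exact hdet)
  have e0 := congrFun hBc 0
  have e1 := congrFun hBc 1
  simp [hB, Matrix.mulVec, dotProduct, Fin.sum_univ_two] at e0 e1
  have hx : c 0 • b 0 + c 1 • b 1 = 0 := by
    refine eq_zero_of_common_kernel (by norm_num) hirr hvq (by simp [h0, h1]) ?_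
    rw [← b.sum_repr' (pencilOp A q (c 0 • b 0 + c 1 • b 1)), Fin.sum_univ_four]
    simp only [map_add, map_smul, inner_add_right, inner_smul_right, hq _ _ h0 h0, hq _ _ h0 h1,
      hq _ _ h1 h0, hq _ _ h1 h1]
    rw [mul_comm (c 0) (inner ℂ (b 2) _), mul_comm (c 1) (inner ℂ (b 2) _),
      mul_comm (c 0) (inner ℂ (b 3) _), mul_comm (c 1) (inner ℂ (b 3) _), e0, e1]
    simp
  apply hc
  have hon := b.orthonormal
  rw [orthonormal_iff_ite] at hon
  funext i
  have i0 := congrArg (fun x => inner ℂ (b 0) x) hx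
  have i1 := congrArg (fun x => inner ℂ (b 1) x) hx
  simp [hon] at i0 i1
  fin_cases i
  · exact i0
  · exact i1

theorem exists_hasEigenvector_two (T : Matrix (Fin 2) (Fin 2) ℂ) :
    ∃ (μ : ℂ) (c : Fin 2 → ℂ), c ≠ 0 ∧ T.mulVec c = μ • c := by
  obtain ⟨μ, hμ⟩ := Module.End.exists_eigenvalue (Matrix.toLin' T)
  obtain ⟨c, hc⟩ := hμ.exists_hasEigenvector
  exact ⟨μ, c, hc.2, by simpa using hc.apply_eq_smul⟩

/-- Write `B` for the off-diagonal block and suppose `B * Bᴴ` were scalar. For `w` in the range of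
the projection with coordinates an eigenvector of the lower block, and `u` the kernel component of
the second pencil at `w`, that pencil sends `w` to `u + μ • w` and `u` to a multiple of `w`. The
span of `w` and `u` would be reducing. -/
theorem not_scalar_of_irreducible (b : OrthonormalBasis (Fin 4) ℂ (EuclideanSpace ℂ (Fin 4)))
    (hirr : IsUnitarilyIrreducible A) {q : Fin 3 → ℝ}
    (hvq : v 0 * q 1 - v 1 * q 0 ≠ 0)
    (h0 : pencilOp A v (b 0) = 0) (h1 : pencilOp A v (b 1) = 0)
    (h2 : pencilOp A v (b 2) = b 2) (h3 : pencilOp A v (b 3) = b 3)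
    (hq : ∀ x y, pencilOp A v x = 0 → pencilOp A v y = 0 → inner ℂ x (pencilOp A q y) = 0)
    {N : Fin 4 → Fin 4 → ℂ} (hN : ∀ i j, N i j = inner ℂ (b i) (pencilOp A q (b j)))
    (hg : N 2 0 * N 0 2 + N 2 1 * N 1 2 = N 3 0 * N 0 3 + N 3 1 * N 1 3)
    (hh : N 2 0 * N 0 3 + N 2 1 * N 1 3 = 0) (hh' : N 3 0 * N 0 2 + N 3 1 * N 1 2 = 0) :
    False := by
  obtain ⟨μ, c, hc, hTc⟩ := exists_hasEigenvector_two !![N 2 2, N 2 3; N 3 2, N 3 3]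
  have e0 := congrFun hTc 0
  have e1 := congrFun hTc 1
  simp [Matrix.mulVec, dotProduct, Fin.sum_univ_two] at e0 e1
  have hexp : ∀ j, pencilOp A q (b j) = N 0 j • b 0 + N 1 j • b 1 + N 2 j • b 2 + N 3 j • b 3 := by
    intro j
    conv_lhs => rw [← b.sum_repr' (pencilOp A q (b j)), Fin.sum_univ_four]
    simp only [hN]
  have N00 : N 0 0 = 0 := by rw [hN, hq _ _ h0 h0]
  have N01 : N 0 1 = 0 := by rw [hN, hq _ _ h0 h1]
  have N10 : N 1 0 = 0 := by rw [hN, hq _ _ h1 h0]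
  have N11 : N 1 1 = 0 := by rw [hN, hq _ _ h1 h1]
  set w := c 0 • b 2 + c 1 • b 3 with hw
  set u := (N 0 2 * c 0 + N 0 3 * c 1) • b 0 + (N 1 2 * c 0 + N 1 3 * c 1) • b 1 with hu
  have hqw : pencilOp A q w = u + μ • w := by
    have : μ • w = (N 2 2 * c 0 + N 2 3 * c 1) • b 2 + (N 3 2 * c 0 + N 3 3 * c 1) • b 3 := by
      rw [e0, e1, hw]; module
    rw [this, hw, map_add, map_smul, map_smul, hexp, hexp, hu]
    module
  have hqu : pencilOp A q u = (N 2 0 * N 0 2 + N 2 1 * N 1 2) • w := by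
    have a2 : N 2 0 * (N 0 2 * c 0 + N 0 3 * c 1) + N 2 1 * (N 1 2 * c 0 + N 1 3 * c 1)
        = (N 2 0 * N 0 2 + N 2 1 * N 1 2) * c 0 := by linear_combination c 1 * hh
    have a3 : N 3 0 * (N 0 2 * c 0 + N 0 3 * c 1) + N 3 1 * (N 1 2 * c 0 + N 1 3 * c 1)
        = (N 2 0 * N 0 2 + N 2 1 * N 1 2) * c 1 := by
      linear_combination c 0 * hh' - c 1 * hg
    have : (N 2 0 * N 0 2 + N 2 1 * N 1 2) • w
        = (N 2 0 * (N 0 2 * c 0 + N 0 3 * c 1) + N 2 1 * (N 1 2 * c 0 + N 1 3 * c 1)) • b 2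
        + (N 3 0 * (N 0 2 * c 0 + N 0 3 * c 1) + N 3 1 * (N 1 2 * c 0 + N 1 3 * c 1)) • b 3 := by
      rw [a2, a3, hw]; module
    rw [this, hu, map_add, map_smul, map_smul, hexp, hexp, N00, N01, N10, N11]
    module
  have hw0 : w ≠ 0 := by
    intro hw0
    apply hc
    have hon := b.orthonormal
    rw [orthonormal_iff_ite] at hon
    have i0 := congrArg (fun x => inner ℂ (b 2) x) hw0
    have i1 := congrArg (fun x => inner ℂ (b 3) x) hw0
    simp [hw, hon] at i0 i1
    funext i
    fin_cases i
    · exact i0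
    · exact i1
  have mw : w ∈ Submodule.span ℂ {w, u} := Submodule.subset_span (by simp)
  have mu : u ∈ Submodule.span ℂ {w, u} := Submodule.subset_span (by simp)
  refine hirr (isUnitarilyReducible_of_span_pair (by norm_num) hvq hw0 (y := u) ?_ ?_ ?_ ?_)
  · have : pencilOp A v w = w := by rw [hw, map_add, map_smul, map_smul, h2, h3]
    rwa [this]
  · have : pencilOp A v u = 0 := by rw [hu, map_add, map_smul, map_smul, h0, h1]; simp
    rw [this]
    exact Submodule.zero_mem _
  · rw [hqw]
    exact Submodule.add_mem _ mu (Submodule.smul_mem _ _ mw)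
  · rw [hqu]
    exact Submodule.smul_mem _ _ mw

end FourByFour

/-! ### Singularities of order two and seeds -/

section Seed

variable {A : Matrix (Fin 4) (Fin 4) ℂ} {v : Fin 3 → ℝ}

theorem eval_basePolynomial_eq_det {n : ℕ} (A : Matrix (Fin n) (Fin n) ℂ)
    (b : OrthonormalBasis (Fin n) ℂ (EuclideanSpace ℂ (Fin n))) (w : Fin 3 → ℂ) :
    MvPolynomial.eval w (basePolynomial A)
      = (star (columnMatrix b) * pencil A w * columnMatrix b).det := by
  rw [eval_basePolynomial, Matrix.det_mul, Matrix.det_mul, mul_right_comm, ← Matrix.det_mul,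
    star_columnMatrix_mul_self, Matrix.det_one, one_mul]

/-- A support line meeting the numerical range in one point, whose pencil has corank two, touches
the boundary generating curve at a singular point. -/
theorem isSingularPoint_of_corank_two (hirr : IsUnitarilyIrreducible A)
    (hv : v 0 ≠ 0 ∨ v 1 ≠ 0) (b : OrthonormalBasis (Fin 4) ℂ (EuclideanSpace ℂ (Fin 4)))
    (h0 : pencilOp A v (b 0) = 0) (h1 : pencilOp A v (b 1) = 0)
    (h2 : pencilOp A v (b 2) = b 2) (h3 : pencilOp A v (b 3) = b 3) {z : ℂ}
    (hz : ∀ x, ‖x‖ = 1 → pencilOp A v x = 0 → inner ℂ x (Matrix.toEuclideanLin A x) = z) :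
    IsSingularPoint (boundaryGeneratingCurve A) (affinePoint z) := by
  set q := conjugatePoint v z with hqdef
  have hvq := conjugatePoint_ne hv z
  have hq : ∀ x y, pencilOp A v x = 0 → pencilOp A v y = 0 → inner ℂ x (pencilOp A q y) = 0 :=
    fun x y hx hy => inner_conjugatePoint_eq_zero hz hx hy
  set N : Fin 4 → Fin 4 → ℂ := fun i j => inner ℂ (b i) (pencilOp A q (b j)) with hN
  have hNc : ∀ i j, conj (N i j) = N j i := fun i j => inner_pencilOp_conj q _ _
  have hdet := offDiagonal_det_ne_zero b hirr hvq h0 h1 hq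
  change N 2 0 * N 3 1 - N 2 1 * N 3 0 ≠ 0 at hdet
  set t₁ : ℝ := (N 2 2).re with ht₁
  set t₂ : ℝ := (N 3 3).re with ht₂
  set g₁ : ℝ := (N 2 0 * N 0 2 + N 2 1 * N 1 2).re with hg₁
  set g₂ : ℝ := (N 3 0 * N 0 3 + N 3 1 * N 1 3).re with hg₂
  set h : ℂ := N 2 0 * N 0 3 + N 2 1 * N 1 3 with hh
  have hh' : conj h = N 3 0 * N 0 2 + N 3 1 * N 1 2 := by
    simp only [hh, map_add, map_mul, hNc]; ring
  have ht₁' : (t₁ : ℂ) = N 2 2 := Complex.conj_eq_iff_re.mp (hNc 2 2)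
  have ht₂' : (t₂ : ℂ) = N 3 3 := Complex.conj_eq_iff_re.mp (hNc 3 3)
  have hg₁' : (g₁ : ℂ) = N 2 0 * N 0 2 + N 2 1 * N 1 2 :=
    Complex.conj_eq_iff_re.mp (by simp only [map_add, map_mul, hNc]; ring)
  have hg₂' : (g₂ : ℂ) = N 3 0 * N 0 3 + N 3 1 * N 1 3 :=
    Complex.conj_eq_iff_re.mp (by simp only [map_add, map_mul, hNc]; ring)
  -- `g₁`, `g₂`, `h` are the entries of `B * Bᴴ` for the off-diagonal block `B`; equality with `h =
  -- 0` would make it scalar.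
  have hdisc : g₁ ≠ g₂ ∨ h ≠ 0 := by
    by_contra hcon
    push Not at hcon
    refine not_scalar_of_irreducible b hirr hvq h0 h1 h2 h3 hq (N := N) (fun _ _ => rfl) ?_
      hcon.2 ?_
    · rw [← hg₁', ← hg₂', hcon.1]
    · rw [← hh', hcon.2, map_zero]
  -- This number is the squared modulus of the determinant of the off-diagonal block.
  have hdet' : g₁ * g₂ - Complex.normSq h ≠ 0 := by
    have hprod : ((g₁ * g₂ - Complex.normSq h : ℝ) : ℂ)
        = (N 2 0 * N 3 1 - N 2 1 * N 3 0) * conj (N 2 0 * N 3 1 - N 2 1 * N 3 0) := by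
      push_cast
      rw [← Complex.mul_conj, hh', hg₁', hg₂', hh]
      simp only [map_sub, map_mul, hNc]
      ring
    intro hcon
    rw [hcon, Complex.ofReal_zero] at hprod
    exact mul_ne_zero hdet ((map_ne_zero _).mpr hdet) hprod.symm
  have hvz : v 0 * z.re + v 1 * z.im + v 2 = 0 := by
    have := inner_pencilOp_self A v (b.orthonormal.1 0)
    rw [h0, inner_zero_right, hz _ (b.orthonormal.1 0) h0] at this
    exact_mod_cast this.symm
  have hon := b.orthonormal
  rw [orthonormal_iff_ite] at hon
  have hE : ∀ y ζ : ℂ, MvPolynomial.eval (complexify v + y • complexify q + ζ • ![0, 0, 1])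
        (basePolynomial A)
      = (ζ * (1 + ζ + y * t₁) - y ^ 2 * g₁) * (ζ * (1 + ζ + y * t₂) - y ^ 2 * g₂)
        - (y * ζ * N 2 3 - y ^ 2 * h) * (y * ζ * conj (N 2 3) - y ^ 2 * conj h) := by
    intro y ζ
    have hp : pencil A (complexify v + y • complexify q + ζ • ![0, 0, 1])
        = pencil A (complexify v) + y • pencil A (complexify q) + ζ • 1 := by
      rw [pencil_add, pencil_add, pencil_smul, pencil_smul]
      simp [pencil]
    have hent : ∀ i j, (star (columnMatrix b)
          * pencil A (complexify v + y • complexify q + ζ • ![0, 0, 1]) * columnMatrix b) i j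
        = inner ℂ (b i) (pencilOp A v (b j)) + y * N i j + ζ * inner ℂ (b i) (b j) := by
      intro i j
      rw [star_columnMatrix_mul_mul_apply, hp, map_add, map_add, map_smul, map_smul,
        Matrix.toLpLin_one]
      simp only [LinearMap.add_apply, LinearMap.smul_apply, LinearMap.id_apply, inner_add_right,
        inner_smul_right]
      rfl
    have hmat : star (columnMatrix b)
          * pencil A (complexify v + y • complexify q + ζ • ![0, 0, 1]) * columnMatrix b
        = !![ζ, 0, y * N 0 2, y * N 0 3; 0, ζ, y * N 1 2, y * N 1 3;
          y * N 2 0, y * N 2 1, 1 + ζ + y * N 2 2, y * N 2 3;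
          y * N 3 0, y * N 3 1, y * N 3 2, 1 + ζ + y * N 3 3] := by
      have N00 : N 0 0 = 0 := hq _ _ h0 h0
      have N01 : N 0 1 = 0 := hq _ _ h0 h1
      have N10 : N 1 0 = 0 := hq _ _ h1 h0
      have N11 : N 1 1 = 0 := hq _ _ h1 h1
      ext i j
      rw [hent]
      fin_cases i <;> fin_cases j <;>
        simp [h0, h1, h2, h3, hon, N00, N01, N10, N11, add_right_comm]
    rw [eval_basePolynomial_eq_det A b, hmat, det_tacnode_pencil, ht₁', ht₂', hg₁', hg₂', hh',
      hNc, hh]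
  have hD : v 0 ^ 2 + v 1 ^ 2 ≠ 0 := by
    rcases hv with h | h <;> positivity
  have hDc : (v 0 : ℂ) ^ 2 + (v 1 : ℂ) ^ 2 ≠ 0 := by exact_mod_cast hD
  have hvzc : (v 2 : ℂ) = -(v 0 * z.re + v 1 * z.im) := by
    rw [eq_neg_iff_add_eq_zero, add_comm]; exact_mod_cast hvz
  refine isSingularPoint_dualCurve (by norm_num) (isHomogeneous_basePolynomial A) _
    fun G k hG hGF => ?_
  -- The vectors `p'`, `q'`, `o'` form the basis dual to `v`, `q`, `(0,0,1)`; orthogonality of `o'`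
  -- to `v` and `q` says that both lines pass through `z`.
  refine grad_eq_zero_of_tacnode (F := basePolynomial A) (v := complexify v) (q := complexify q)
    (o := ![0, 0, 1])
    (p' := ![v 0 / (v 0 ^ 2 + v 1 ^ 2), v 1 / (v 0 ^ 2 + v 1 ^ 2), 0])
    (q' := ![-v 1 / (v 0 ^ 2 + v 1 ^ 2), v 0 / (v 0 ^ 2 + v 1 ^ 2), 0])
    (o' := ![(z.re : ℂ), (z.im : ℂ), 1]) (t₁ := t₁) (t₂ := t₂) (g₁ := g₁) (g₂ := g₂)
    (r := N 2 3) (h := h) ?_ ?_ ?_ ?_ hE (isHomogeneous_basePolynomial A) hdisc hdet' hG hGF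
  · intro u
    funext i
    simp only [dotProduct, Fin.sum_univ_three, hqdef, conjugatePoint, complexify, Pi.add_apply,
      Pi.smul_apply, smul_eq_mul]
    fin_cases i
    · simp
      rw [hvzc]
      field_simp
      ring
    · simp
      rw [hvzc]
      field_simp
      ring
    · simp
  all_goals simp [dotProduct, Fin.sum_univ_three]

/-- If the pencil of an irreducible matrix of order four is at `v` an orthogonal projection of
rank one or two, then `v` is a singularity that corresponds to a seed. -/
theorem isSeedSingularity_of_projection (hirr : IsUnitarilyIrreducible A)
    (hv : v 0 ≠ 0 ∨ v 1 ≠ 0) (b : OrthonormalBasis (Fin 4) ℂ (EuclideanSpace ℂ (Fin 4)))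
    (h0 : pencilOp A v (b 0) = 0) (h1 : pencilOp A v (b 1) = 0)
    (h2 : pencilOp A v (b 2) = 0 ∨ pencilOp A v (b 2) = b 2) (h3 : pencilOp A v (b 3) = b 3) :
    IsSeedSingularity A (Projectivization.mk ℂ (complexify v) (complexify_ne_zero hv)) := by
  have hpos : (pencilOp A v).IsPositive := by
    refine pencilOp_isPositive_of_forall_basis b fun j => ?_
    fin_cases j
    · exact Or.inl h0
    · exact Or.inl h1
    · exact h2
    · exact Or.inr h3
  have hline := isSupportLine_dualLine_mk hv hpos (b.orthonormal.1 0) h0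
  set P := Projectivization.mk ℂ (complexify v) (complexify_ne_zero hv) with hP
  have hord : 2 ≤ curveOrder (basePolynomial A) P := by
    refine le_trans (by simp) (card_le_curveOrder_mk (complexify_ne_zero hv) b {0, 1} ?_)
    intro j hj
    rcases Finset.mem_insert.mp hj with rfl | hj
    · exact h0
    · rw [Finset.mem_singleton.mp hj]; exact h1
  refine ⟨⟨v, complexify_ne_zero hv, rfl⟩, hord, ?_⟩
  by_cases hflat : (frontier (numericalRange A) ∩ dualLine P).Nontrivial
  · exact ⟨_, Or.inl ⟨⟨_, hline, rfl⟩, hflat⟩, hline, Set.inter_subset_right⟩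
  rw [Set.not_nontrivial_iff] at hflat
  have hmem : ∀ x, ‖x‖ = 1 → pencilOp A v x = 0 →
      inner ℂ x (Matrix.toEuclideanLin A x) ∈ frontier (numericalRange A) ∩ dualLine P := by
    intro x hx hx0
    refine ⟨mem_frontier_of_pencilOp A hv hpos hx hx0, ?_⟩
    rw [hP, mem_dualLine_mk_iff]
    have := inner_pencilOp_self A v hx
    rw [hx0, inner_zero_right] at this
    exact_mod_cast this.symm
  have hb0 := hmem _ (b.orthonormal.1 0) h0
  have hz : ∀ x, ‖x‖ = 1 → pencilOp A v x = 0 → inner ℂ x (Matrix.toEuclideanLin A x)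
      = inner ℂ (b 0) (Matrix.toEuclideanLin A (b 0)) :=
    fun x hx hx0 => hflat (hmem x hx hx0) hb0
  rcases h2 with h2 | h2
  -- In corank three with one contact point, `b 2` is in the kernel too. The row of the off-diagonal
  -- block belonging to it vanishes, which irreducibility forbids.
  · exfalso
    have hq : ∀ x y, pencilOp A v x = 0 → pencilOp A v y = 0 →
        inner ℂ x (pencilOp A (conjugatePoint v _) y) = 0 :=
      fun x y hx hy => inner_conjugatePoint_eq_zero hz hx hy
    refine offDiagonal_det_ne_zero b hirr (conjugatePoint_ne hv _) h0 h1 hq ?_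
    rw [hq _ _ h2 h0, hq _ _ h2 h1]
    ring
  · exact ⟨_, Or.inr ⟨_, hb0.1, isSingularPoint_of_corank_two hirr hv b h0 h1 h2 h3 hz, rfl⟩,
      hline, Set.singleton_subset_iff.mpr hb0.2⟩

end Seed

/-! ### Lower bound -/

section LowerBound

variable {n : ℕ} {A : Matrix (Fin n) (Fin n) ℂ} {v : Fin 3 → ℝ}

theorem pencilOp_isPositive_of_eigenbasis
    (b : OrthonormalBasis (Fin n) ℂ (EuclideanSpace ℂ (Fin n))) (l : Fin n → ℝ)
    (hl : ∀ j, 0 ≤ l j) (h : ∀ j, pencilOp A v (b j) = (l j : ℂ) • b j) :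
    (pencilOp A v).IsPositive := by
  refine ⟨pencilOp_isSymmetric A v, fun x => ?_⟩
  rw [← b.sum_inner_mul_inner, map_sum]
  refine Finset.sum_nonneg fun i _ => ?_
  rw [pencilOp_isSymmetric, h, inner_smul_right, mul_assoc, ← inner_conj_symm x (b i),
    Complex.conj_mul', ← Complex.ofReal_pow, ← Complex.ofReal_mul, RCLike.re_to_complex,
    Complex.ofReal_re]
  exact mul_nonneg (hl i) (sq_nonneg _)

theorem pencilOp_origin (x : EuclideanSpace ℂ (Fin n)) : pencilOp A ![0, 0, 1] x = x := by
  simp [pencilOp_apply]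

/-- The real point at which the pencil is `d` minus the pencil at `v`. -/
def complementPoint (d : ℝ) (v : Fin 3 → ℝ) : Fin 3 → ℝ :=
  ![-v 0, -v 1, d - v 2]

theorem complementPoint_ne {d : ℝ} (hv : v 0 ≠ 0 ∨ v 1 ≠ 0) :
    complementPoint d v 0 ≠ 0 ∨ complementPoint d v 1 ≠ 0 := by
  simpa [complementPoint] using hv

theorem pencilOp_complementPoint (d : ℝ) (x : EuclideanSpace ℂ (Fin n)) :
    pencilOp A (complementPoint d v) x = (d : ℂ) • x - pencilOp A v x := by
  rw [pencilOp_apply, pencilOp_apply]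
  simp only [complementPoint, Matrix.cons_val]
  push_cast
  module

/-- A real point is determined by its dual line. -/
theorem exists_smul_of_dualLine_mk_eq {w : Fin 3 → ℝ} (hw : complexify w ≠ 0)
    (hv : v 0 ≠ 0 ∨ v 1 ≠ 0)
    (h : dualLine (Projectivization.mk ℂ (complexify w) hw)
      = {z : ℂ | v 0 * z.re + v 1 * z.im + v 2 = 0}) :
    ∃ κ : ℝ, κ ≠ 0 ∧ w = κ • v := by
  have hD : v 0 ^ 2 + v 1 ^ 2 ≠ 0 := by
    rcases hv with h | h <;> positivity
  have hiff : ∀ z : ℂ, v 0 * z.re + v 1 * z.im + v 2 = 0 →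
      w 0 * z.re + w 1 * z.im + w 2 = 0 := by
    intro z hz
    rw [← mem_dualLine_mk_iff hw, h]
    exact hz
  -- The foot of the perpendicular from the origin, and then a second point of the line shifted by
  -- `(-v 1, v 0)`, suffice to compare coefficients.
  set X := -v 0 * v 2 / (v 0 ^ 2 + v 1 ^ 2) with hX
  set Y := -v 1 * v 2 / (v 0 ^ 2 + v 1 ^ 2) with hY
  have e0 : v 0 * X + v 1 * Y + v 2 = 0 := by
    rw [hX, hY]; field_simp; ring
  have e1 := hiff ⟨X, Y⟩ e0
  have e2 := hiff ⟨X - v 1, Y + v 0⟩ (by simp only; linear_combination e0)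
  simp only at e1 e2
  set κ := (w 0 * v 0 + w 1 * v 1) / (v 0 ^ 2 + v 1 ^ 2) with hκ
  have e3 : w 1 * v 0 = w 0 * v 1 := by linear_combination e2 - e1
  have w0 : w 0 = κ * v 0 := by
    rw [hκ]; field_simp; linear_combination v 1 * -e3
  have w1 : w 1 = κ * v 1 := by
    rw [hκ]; field_simp; linear_combination v 0 * e3
  have w2 : w 2 = κ * v 2 := by
    rw [w0, w1] at e1
    linear_combination e1 - κ * e0
  have hwv : w = κ • v := by
    funext i
    fin_cases i
    · exact w0
    · exact w1
    · exact w2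
  refine ⟨κ, ?_, hwv⟩
  intro h0
  apply hw
  rw [hwv, h0]
  funext i
  simp [complexify]

/-- Two null eigenvectors of the pencil lie over the support line of `P`; an eigenvector for the
largest eigenvalue lies over the opposite parallel support line. -/
theorem three_mem_boundarySystemSizes (hn : 3 ≤ n) (hirr : IsUnitarilyIrreducible A) {P : CP2}
    (hP : IsSeedSingularity A P) : 3 ∈ boundarySystemSizes A := by
  obtain ⟨⟨w, hw, rfl⟩, hord, -, -, ⟨a, b, c, hab, hline, -, hpos⟩, -⟩ := hP
  -- The coefficients of the support line fix the sign that makes the pencil positive; the given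
  -- real representative `w` may be any nonzero real multiple.
  set v : Fin 3 → ℝ := ![a, b, c] with hvdef
  have hv : v 0 ≠ 0 ∨ v 1 ≠ 0 := hab
  have hposv : (pencilOp A v).IsPositive := (pencilOp_isPositive_iff A v).mpr hpos
  obtain ⟨κ, hκ, hwv⟩ := exists_smul_of_dualLine_mk_eq (v := v) hw hv hline
  obtain ⟨d, hd, hrep⟩ := exists_rep_mk_eq_smul hw
  have hrep' : (Projectivization.mk ℂ (fun i => (w i : ℂ)) hw).rep
      = (d * κ) • complexify v := by
    rw [hrep, hwv]
    funext i
    simp [complexify, mul_assoc]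
  obtain ⟨i, j, hij, hi, hj⟩ := exists_eigenvalues_eq_zero_of_two_le_curveOrder (A := A)
    (mul_ne_zero hd (by exact_mod_cast hκ)) hrep' hord
  set hH := isHermitian_pencil A v with hHdef
  set e := hH.eigenvectorBasis with he
  set l := hH.eigenvalues with hl
  have hel : ∀ m, pencilOp A v (e m) = (l m : ℂ) • e m := by
    intro m
    rw [pencilOp, Matrix.toLpLin_apply]
    have := hH.mulVec_eigenvectorBasis m
    rw [this]
    ext r
    simp [he, hl]
  have hne : Nonempty (Fin n) := ⟨i⟩
  obtain ⟨k, hk⟩ := Finite.exists_max l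
  have hlpos : ∀ m, 0 ≤ l m := by
    intro m
    have := hposv.re_inner_nonneg_right (e m)
    rw [hel, inner_smul_right, inner_self_eq_norm_sq_to_K, e.orthonormal.1 m] at this
    simpa using this
  -- If the largest eigenvalue were zero, the pencil would vanish and the matrix would be reducible.
  have hk0 : l k ≠ 0 := by
    intro h0
    refine hirr (isUnitarilyReducible_of_pencilOp_eq_zero hn hv ?_)
    refine e.toBasis.ext fun m => ?_
    have : l m = 0 := le_antisymm (h0 ▸ hk m) (hlpos m)
    rw [OrthonormalBasis.coe_toBasis, hel, this]
    simp
  set u : Fin 3 → ℝ := complementPoint (l k) v with hu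
  have hu01 : u 0 ≠ 0 ∨ u 1 ≠ 0 := complementPoint_ne hv
  have hue : ∀ m, pencilOp A u (e m) = ((l k - l m : ℝ) : ℂ) • e m := by
    intro m
    rw [hu, pencilOp_complementPoint, hel, ← sub_smul]
    push_cast; rfl
  have hupos : (pencilOp A u).IsPositive :=
    pencilOp_isPositive_of_eigenbasis e (fun m => l k - l m) (fun m => sub_nonneg.mpr (hk m)) hue
  have hki : i ≠ k := fun h => hk0 (h ▸ hi)
  have hkj : j ≠ k := fun h => hk0 (h ▸ hj)
  refine ⟨e ∘ ![i, j, k], e.orthonormal.comp _ ?_, fun m => ?_⟩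
  · intro m m' hmm
    fin_cases m <;> fin_cases m' <;> simp_all
  · have hzero : ∀ m, l m = 0 → inner ℂ (e m) (Matrix.toEuclideanLin A (e m))
        ∈ frontier (numericalRange A) := fun m hm =>
      mem_frontier_of_pencilOp A hv hposv (e.orthonormal.1 m) (by rw [hel, hm]; simp)
    fin_cases m
    · exact hzero i hi
    · exact hzero j hj
    · exact mem_frontier_of_pencilOp A hu01 hupos (e.orthonormal.1 k)
        ((hue k).trans (by rw [sub_self, Complex.ofReal_zero, zero_smul]))

end LowerBound

/-! ### Upper bound -/

section UpperBound

variable {n : ℕ} {A : Matrix (Fin n) (Fin n) ℂ}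

/-- Pairing `x` with either pencil applied to `y` gives zero, once by symmetry and once directly. As
`x` is orthogonal to `y`, these are two independent linear equations for the mixed terms of `H₁` and
`H₂`. -/
theorem inner_map_eq_zero_of_not_parallel {v w : Fin 3 → ℝ} {x y : EuclideanSpace ℂ (Fin n)}
    (hxy : inner ℂ x y = 0) (hx : pencilOp A v x = 0) (hy : pencilOp A w y = 0)
    (hvw : v 0 * w 1 - v 1 * w 0 ≠ 0) : inner ℂ x (Matrix.toEuclideanLin A y) = 0 := by
  have e1 : inner ℂ x (pencilOp A v y) = 0 := by
    rw [← pencilOp_isSymmetric, hx, inner_zero_left]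
  have e2 : inner ℂ x (pencilOp A w y) = 0 := by rw [hy, inner_zero_right]
  rw [pencilOp_apply, inner_add_right, inner_add_right, inner_smul_right, inner_smul_right,
    inner_smul_right, hxy] at e1 e2
  have hd : (v 0 : ℂ) * w 1 - v 1 * w 0 ≠ 0 := by exact_mod_cast hvw
  have hre : inner ℂ x (Matrix.toEuclideanLin (rePart A) y) = 0 := by
    refine (mul_eq_zero.mp ?_).resolve_left hd
    linear_combination (w 1 : ℂ) * e1 - (v 1 : ℂ) * e2
  have him : inner ℂ x (Matrix.toEuclideanLin (imPart A) y) = 0 := by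
    refine (mul_eq_zero.mp ?_).resolve_left hd
    linear_combination (v 0 : ℂ) * e2 - (w 0 : ℂ) * e1
  rw [toEuclideanLin_apply_eq, inner_add_right, inner_smul_right, hre, him]
  simp

theorem cross_eq_zero_trans {u v w : Fin 3 → ℝ} (hv : v 0 ≠ 0 ∨ v 1 ≠ 0)
    (huv : u 0 * v 1 - u 1 * v 0 = 0) (hvw : v 0 * w 1 - v 1 * w 0 = 0) :
    u 0 * w 1 - u 1 * w 0 = 0 := by
  rcases hv with h | h
  · refine (mul_eq_zero.mp ?_).resolve_left h
    linear_combination w 0 * huv + u 0 * hvw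
  · refine (mul_eq_zero.mp ?_).resolve_left h
    linear_combination w 1 * huv + u 1 * hvw

theorem exists_proportional {v w : Fin 3 → ℝ} (hv : v 0 ≠ 0 ∨ v 1 ≠ 0) (hw : w 0 ≠ 0 ∨ w 1 ≠ 0)
    (h : v 0 * w 1 - v 1 * w 0 = 0) : ∃ κ c : ℝ, κ ≠ 0 ∧ w = κ • v + c • ![0, 0, 1] := by
  have hD : v 0 ^ 2 + v 1 ^ 2 ≠ 0 := by
    rcases hv with h | h <;> positivity
  set κ := (w 0 * v 0 + w 1 * v 1) / (v 0 ^ 2 + v 1 ^ 2) with hκ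
  have w0 : w 0 = κ * v 0 := by
    rw [hκ]; field_simp; linear_combination v 1 * -h
  have w1 : w 1 = κ * v 1 := by
    rw [hκ]; field_simp; linear_combination v 0 * h
  refine ⟨κ, w 2 - κ * v 2, ?_, ?_⟩
  · intro h0
    rw [h0, zero_mul] at w0 w1
    exact hw.elim (fun h => h w0) (fun h => h w1)
  · funext i
    fin_cases i
    · simpa using w0
    · simpa using w1
    · simp

/-- An irreducible matrix whose Gau–Wu number is its order has a pencil that is diagonal with
entries `0` and `1` in an orthonormal basis. -/
theorem exists_projection_of_full_system (hn : 3 ≤ n) (hirr : IsUnitarilyIrreducible A)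
    (b : OrthonormalBasis (Fin n) ℂ (EuclideanSpace ℂ (Fin n)))
    (hb : ∀ j, inner ℂ (b j) (Matrix.toEuclideanLin A (b j)) ∈ frontier (numericalRange A)) :
    ∃ v : Fin 3 → ℝ, (v 0 ≠ 0 ∨ v 1 ≠ 0) ∧
      (∀ j, pencilOp A v (b j) = 0 ∨ pencilOp A v (b j) = b j) ∧
      (∃ j, pencilOp A v (b j) = 0) ∧ ∃ j, pencilOp A v (b j) = b j := by
  choose w hw hpos hker using
    fun j => exists_pencilOp_of_mem_frontier A (b.orthonormal.1 j) (hb j)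
  set i₀ : Fin n := ⟨0, by omega⟩ with hi₀
  -- Otherwise the vectors parallel to the first one and the remaining ones would split `A` into two
  -- blocks.
  have hpar : ∀ j, w i₀ 0 * w j 1 - w i₀ 1 * w j 0 = 0 := by
    by_contra hcon
    push Not at hcon
    obtain ⟨j, hj⟩ := hcon
    refine hirr (isUnitarilyReducible_of_orthonormalBasis b
      (fun i => w i₀ 0 * w i 1 - w i₀ 1 * w i 0 = 0) ⟨i₀, by ring⟩ ⟨j, hj⟩ ?_)
    intro i k hi hk
    have hik : i ≠ k := by
      rintro rfl
      exact hk hi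
    have hcr : w i 0 * w k 1 - w i 1 * w k 0 ≠ 0 :=
      fun h => hk (cross_eq_zero_trans (hw i) hi h)
    have hcr' : w k 0 * w i 1 - w k 1 * w i 0 ≠ 0 := by
      intro h
      apply hcr
      linear_combination -h
    exact ⟨inner_map_eq_zero_of_not_parallel (b.orthonormal.2 hik) (hker i) (hker k) hcr,
      inner_map_eq_zero_of_not_parallel (b.orthonormal.2 hik.symm) (hker k) (hker i) hcr'⟩
  choose κ c hκ hwκ using fun j => exists_proportional (hw i₀) (hw j) (hpar j)
  set v := w i₀ with hv
  set μ : Fin n → ℝ := fun j => -c j / κ j with hμ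
  have hop : ∀ j x, pencilOp A (w j) x = (κ j : ℂ) • pencilOp A v x + (c j : ℂ) • x := by
    intro j x
    rw [hwκ j, pencilOp_add, pencilOp_smul, pencilOp_smul, LinearMap.add_apply,
      LinearMap.smul_apply, LinearMap.smul_apply, pencilOp_origin]
  have heig : ∀ j, pencilOp A v (b j) = (μ j : ℂ) • b j := by
    intro j
    have h1 := hker j
    rw [hop, add_eq_zero_iff_eq_neg, ← neg_smul] at h1
    have hκc : (κ j : ℂ) ≠ 0 := by exact_mod_cast hκ j
    have h2 := congrArg (fun x => (κ j : ℂ)⁻¹ • x) h1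
    simp only [smul_smul, inv_mul_cancel₀ hκc, one_smul] at h2
    rw [h2, hμ]
    push_cast
    rw [div_eq_inv_mul]
  -- Positivity of the pencil at `w j`, tested on `b i`: for `κ j > 0` the eigenvalue `μ j` is the
  -- smallest, for `κ j < 0` the largest. Hence only two values occur.
  have hcomp : ∀ i j, 0 ≤ κ j * (μ i - μ j) := by
    intro i j
    have h1 := (hpos j).re_inner_nonneg_right (b i)
    rw [hop, heig, smul_smul, ← add_smul, inner_smul_right, inner_self_eq_norm_sq_to_K,
      b.orthonormal.1 i] at h1
    simp at h1
    have h2 : κ j * μ j = -c j := by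
      rw [hμ]; field_simp [hκ j]
    rw [mul_sub, h2]
    linarith
  have hμ0 : μ i₀ = 0 := by
    have h1 := hker i₀
    rw [← hv, heig] at h1
    have hb0 : b i₀ ≠ 0 := b.orthonormal.ne_zero i₀
    exact_mod_cast (smul_eq_zero.mp h1).resolve_right hb0
  have hμnn : ∀ j, 0 ≤ μ j := by
    intro j
    have h1 := (hpos i₀).re_inner_nonneg_right (b j)
    rw [← hv, heig, inner_smul_right, inner_self_eq_norm_sq_to_K, b.orthonormal.1 j] at h1
    simpa using h1
  obtain ⟨k, hk⟩ : ∃ k, μ k ≠ 0 := by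
    by_contra hcon
    push Not at hcon
    refine hirr (isUnitarilyReducible_of_pencilOp_eq_zero hn (hw i₀) ?_)
    refine b.toBasis.ext fun j => ?_
    rw [OrthonormalBasis.coe_toBasis, ← hv, heig, hcon j]
    simp
  have hkpos : 0 < μ k := lt_of_le_of_ne (hμnn k) hk.symm
  have hposκ : ∀ j, 0 < κ j → μ j = 0 := by
    intro j hj
    have h1 := nonneg_of_mul_nonneg_right (hcomp i₀ j) hj
    rw [hμ0] at h1
    linarith [hμnn j]
  have hnegκ : ∀ i j, κ j < 0 → μ i ≤ μ j := by
    intro i j hj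
    have h1 := hcomp i j
    nlinarith
  have hkneg : κ k < 0 := by
    rcases lt_or_gt_of_ne (hκ k) with h | h
    · exact h
    · exact absurd (hposκ k h) hk
  have hval : ∀ j, μ j = 0 ∨ μ j = μ k := by
    intro j
    rcases lt_or_gt_of_ne (hκ j) with h | h
    · exact Or.inr (le_antisymm (hnegκ j k hkneg) (hnegκ k j h))
    · exact Or.inl (hposκ j h)
  have hfin : ∀ j, pencilOp A ((μ k)⁻¹ • v) (b j) = (((μ k)⁻¹ * μ j : ℝ) : ℂ) • b j := by
    intro j
    rw [pencilOp_smul, LinearMap.smul_apply, heig, smul_smul, Complex.ofReal_mul]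
  have hz : ∀ j, μ j = 0 → pencilOp A ((μ k)⁻¹ • v) (b j) = 0 := by
    intro j hj
    rw [hfin, hj]; simp
  have ho : ∀ j, μ j = μ k → pencilOp A ((μ k)⁻¹ • v) (b j) = b j := by
    intro j hj
    rw [hfin, hj, inv_mul_cancel₀ hk]; simp
  refine ⟨(μ k)⁻¹ • v, ?_, fun j => (hval j).imp (hz j) (ho j), ⟨i₀, hz _ hμ0⟩, ⟨k, ho _ rfl⟩⟩
  exact (hw i₀).imp (fun h => mul_ne_zero (inv_ne_zero hk) h)
    (fun h => mul_ne_zero (inv_ne_zero hk) h)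

theorem exists_perm_of_card (S : Finset (Fin 4)) (h : 2 ≤ S.card) (h' : S ≠ Finset.univ) :
    ∃ σ : Equiv.Perm (Fin 4), σ 0 ∈ S ∧ σ 1 ∈ S ∧ σ 3 ∉ S := by
  obtain ⟨i, hi, j, hj, hij⟩ := Finset.one_lt_card.mp h
  obtain ⟨k, hk⟩ : ∃ k, k ∉ S := by
    by_contra hcon
    push Not at hcon
    exact h' (Finset.eq_univ_iff_forall.mpr hcon)
  have hki : k ≠ i := fun h => hk (h ▸ hi)
  have hkj : k ≠ j := fun h => hk (h ▸ hj)
  have : ∀ i j k : Fin 4, i ≠ j → k ≠ i → k ≠ j →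
      ∃ σ : Equiv.Perm (Fin 4), σ 0 = i ∧ σ 1 = j ∧ σ 3 = k := by decide
  obtain ⟨σ, h0, h1, h3⟩ := this i j k hij hki hkj
  exact ⟨σ, h0 ▸ hi, h1 ▸ hj, h3 ▸ hk⟩

theorem isSeedSingularity_of_card {A : Matrix (Fin 4) (Fin 4) ℂ} (hirr : IsUnitarilyIrreducible A)
    {v : Fin 3 → ℝ} (hv : v 0 ≠ 0 ∨ v 1 ≠ 0)
    (b : OrthonormalBasis (Fin 4) ℂ (EuclideanSpace ℂ (Fin 4))) (S : Finset (Fin 4))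
    (hS : ∀ j ∈ S, pencilOp A v (b j) = 0) (hS' : ∀ j ∉ S, pencilOp A v (b j) = b j)
    (hc : 2 ≤ S.card) (hne : S ≠ Finset.univ) :
    IsSeedSingularity A (Projectivization.mk ℂ (complexify v) (complexify_ne_zero hv)) := by
  obtain ⟨σ, h0, h1, h3⟩ := exists_perm_of_card S hc hne
  refine isSeedSingularity_of_projection hirr hv (b.reindex σ.symm) ?_ ?_ ?_ ?_
  · simpa using hS _ h0
  · simpa using hS _ h1
  · by_cases h2 : σ 2 ∈ S
    · exact Or.inl (by simpa using hS _ h2)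
    · exact Or.inr (by simpa using hS' _ h2)
  · simpa using hS' _ h3

/-- The three coefficient vectors are related by `(0,0,1) = v + complementPoint 1 v`. -/
theorem not_independent_complement {v : Fin 3 → ℝ} (hv : complexify v ≠ 0)
    (hu : complexify (complementPoint 1 v) ≠ 0) :
    ¬ Projectivization.Independent ![origin, Projectivization.mk ℂ (complexify v) hv,
      Projectivization.mk ℂ (complexify (complementPoint 1 v)) hu] := by
  rw [← Projectivization.dependent_iff_not_independent]
  have hone : (![((0 : ℂ).re : ℂ), ((0 : ℂ).im : ℂ), 1] : Fin 3 → ℂ) ≠ 0 :=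
    fun h => one_ne_zero (congrFun h 2)
  have hne : ∀ i, (![![((0 : ℂ).re : ℂ), ((0 : ℂ).im : ℂ), 1], complexify v,
      complexify (complementPoint 1 v)] : Fin 3 → Fin 3 → ℂ) i ≠ 0 := by
    intro i
    fin_cases i
    · exact hone
    · exact hv
    · exact hu
  have hdep := Projectivization.Dependent.mk (K := ℂ) _ hne (by
    rw [Fintype.not_linearIndependent_iff]
    refine ⟨![1, -1, -1], ?_, 0, by simp⟩
    rw [Fin.sum_univ_three]
    funext i
    fin_cases i
    · simp [complexify, complementPoint, Matrix.vecHead]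
    · simp [complexify, complementPoint, Matrix.vecHead, Matrix.vecTail]
    · simp [complexify, complementPoint, Matrix.vecHead, Matrix.vecTail]
      ring)
  convert hdep using 1
  funext i
  fin_cases i <;> rfl

/-- The first two coordinates force the ratio `-1`, which the third excludes: the dual lines are
parallel but distinct. -/
theorem mk_ne_mk_complement {v : Fin 3 → ℝ} (hv01 : v 0 ≠ 0 ∨ v 1 ≠ 0) (hv : complexify v ≠ 0)
    (hu : complexify (complementPoint 1 v) ≠ 0) :
    Projectivization.mk ℂ (complexify v) hv
      ≠ Projectivization.mk ℂ (complexify (complementPoint 1 v)) hu := by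
  intro h
  obtain ⟨a, ha⟩ := (Projectivization.mk_eq_mk_iff' ℂ _ _ hv hu).mp h
  have e0 := congrFun ha 0
  have e1 := congrFun ha 1
  have e2 := congrFun ha 2
  simp [complexify, complementPoint] at e0 e1 e2
  have ha1 : a = -1 := by
    rcases hv01 with h | h
    · have : (v 0 : ℂ) ≠ 0 := by exact_mod_cast h
      refine mul_right_cancel₀ this ?_
      linear_combination -e0
    · have : (v 1 : ℂ) ≠ 0 := by exact_mod_cast h
      refine mul_right_cancel₀ this ?_
      linear_combination -e1
  rw [ha1] at e2
  have : (1 : ℂ) = 0 := by linear_combination -e2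
  exact one_ne_zero this

end UpperBound

end GauWu

end

/-! ### The Gau–Wu number is three -/

theorem theorem4p3 (A : Matrix (Fin 4) (Fin 4) ℂ)
    (hirr : GauWu.IsUnitarilyIrreducible A)
    (hex : ∃ P : GauWu.CP2, GauWu.IsSeedSingularity A P)
    (hord : ∀ P : GauWu.CP2, GauWu.IsSeedSingularity A P →
      GauWu.curveOrder (GauWu.basePolynomial A) P = 2)
    (hcol : ∀ P Q : GauWu.CP2, GauWu.IsSeedSingularity A P → GauWu.IsSeedSingularity A Q →
      P ≠ Q → Projectivization.Independent ![GauWu.origin, P, Q]) :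
    GauWu.gauWuNumber A = 3 := by
  classical
  obtain ⟨P, hP⟩ := hex
  refine le_antisymm ?_ ((GauWu.gauWuNumber_isGreatest A).2
    (GauWu.three_mem_boundarySystemSizes (by norm_num) hirr hP))
  have hle : GauWu.gauWuNumber A ≤ 4 := by
    obtain ⟨x, hx, -⟩ := (GauWu.gauWuNumber_isGreatest A).1
    simpa using hx.linearIndependent.fintype_card_le_finrank
  by_contra hlt
  have h4 : 4 ∈ GauWu.boundarySystemSizes A := by
    have := (GauWu.gauWuNumber_isGreatest A).1
    rwa [show GauWu.gauWuNumber A = 4 by omega] at this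
  obtain ⟨x, hx, hxf⟩ := h4
  obtain ⟨b, hb⟩ := Orthonormal.exists_orthonormalBasis_extension_of_card_eq
    (𝕜 := ℂ) (v := x) (s := Set.univ) (by simp) (hx.comp _ Subtype.val_injective)
  obtain ⟨v, hv, hall, ⟨i, hi⟩, ⟨j, hj⟩⟩ := GauWu.exists_projection_of_full_system
    (by norm_num) hirr b (fun j => by rw [hb j (Set.mem_univ j)]; exact hxf j)
  -- The pencil at `u` is the complementary projection, so the kernels at `v` and `u` are spanned by
  -- complementary parts of the basis.
  set u := GauWu.complementPoint 1 v with hu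
  have hu01 : u 0 ≠ 0 ∨ u 1 ≠ 0 := GauWu.complementPoint_ne hv
  have hop : ∀ k, GauWu.pencilOp A u (b k) = b k - GauWu.pencilOp A v (b k) := by
    intro k
    rw [hu, GauWu.pencilOp_complementPoint, Complex.ofReal_one, one_smul]
  have hb0 : ∀ k, b k ≠ 0 := fun k => b.orthonormal.ne_zero k
  set S : Finset (Fin 4) := {k | GauWu.pencilOp A v (b k) = 0} with hS
  have hSm : ∀ k, k ∈ S ↔ GauWu.pencilOp A v (b k) = 0 := fun k => by simp [hS]
  have hiS : i ∈ S := (hSm i).mpr hi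
  have hjS : j ∉ S := fun h => hb0 j (hj.symm.trans ((hSm j).mp h))
  have hSu : S ≠ Finset.univ := fun h => hjS (h ▸ Finset.mem_univ j)
  have hSu' : Sᶜ ≠ Finset.univ := fun h => Finset.mem_compl.mp (h ▸ Finset.mem_univ i) hiS
  have hv0 : ∀ k ∈ S, GauWu.pencilOp A v (b k) = 0 := fun k hk => (hSm k).mp hk
  have hv1 : ∀ k ∉ S, GauWu.pencilOp A v (b k) = b k :=
    fun k hk => (hall k).resolve_left fun h => hk ((hSm k).mpr h)
  have hu0 : ∀ k ∈ Sᶜ, GauWu.pencilOp A u (b k) = 0 := fun k hk => by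
    rw [hop, hv1 k (Finset.mem_compl.mp hk), sub_self]
  have hu1 : ∀ k ∉ Sᶜ, GauWu.pencilOp A u (b k) = b k := fun k hk => by
    rw [hop, hv0 k (by simpa using hk), sub_zero]
  have hcard : S.card + Sᶜ.card = 4 := by simp [Finset.card_add_card_compl]
  have hpos : 0 < S.card := Finset.card_pos.mpr ⟨i, hiS⟩
  have hpos' : 0 < Sᶜ.card := Finset.card_pos.mpr ⟨j, Finset.mem_compl.mpr hjS⟩
  -- A kernel of dimension three would give a seed singularity of order at least three.
  have hle2 : S.card ≤ 2 := by
    by_contra hcon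
    have hP := GauWu.isSeedSingularity_of_card hirr hv b S hv0 hv1 (by omega) hSu
    have h1 := GauWu.card_le_curveOrder_mk (GauWu.complexify_ne_zero hv) b S hv0
    rw [hord _ hP] at h1
    exact hcon (by exact_mod_cast h1)
  have hle2' : Sᶜ.card ≤ 2 := by
    by_contra hcon
    have hP := GauWu.isSeedSingularity_of_card hirr hu01 b Sᶜ hu0 hu1 (by omega) hSu'
    have h1 := GauWu.card_le_curveOrder_mk (GauWu.complexify_ne_zero hu01) b Sᶜ hu0
    rw [hord _ hP] at h1
    exact hcon (by exact_mod_cast h1)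
  -- Both kernels now have dimension exactly two, so `v` and `u` are distinct seed singularities
  -- collinear with the origin.
  exact GauWu.not_independent_complement (GauWu.complexify_ne_zero hv)
    (GauWu.complexify_ne_zero hu01) (hcol _ _
      (GauWu.isSeedSingularity_of_card hirr hv b S hv0 hv1 (by omega) hSu)
      (GauWu.isSeedSingularity_of_card hirr hu01 b Sᶜ hu0 hu1 (by omega) hSu')
      (GauWu.mk_ne_mk_complement hv _ _))
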